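/- Represent an oriented line $\{x\in\mathbb R^2:\langle \mathbf v,x\rangle=d\}$ with unit normal $\mathbf v=(v,w)$ by the point $(v,w,d)$ of the Blaschke cylinder $\mathcal Z=\{v^2+w^2=1\}\subset\mathbb R^3$. It is in oriented contact with the circle of centre $c$ and signed radius $r\in\mathbb R$ if $\langle c,\mathbf v\rangle-r=d$. A checkerboard IC-net consists of oriented lines $\ell_i,m_j$ $(i,j\in\mathbb Z)$ such that for all $k,n\in\mathbb Z$ the lines $\ell_{2k},\ell_{2k+1},m_{2n},m_{2n+1}$, as well as the lines $\ell_{2k-1},\ell_{2k},m_{2n-1},m_{2n}$, have a common circle in oriented contact (vertices $\ell_i\cap m_j$ at infinity are allowed). It is confocal if all its lines are tangent to one ellipse or hyperbola (asymptotes of a hyperbola count as tangent lines) or, in the degenerate case of a collapsed conic, if there are two distinct points (the foci) such that each line passes through at least one of them. A Laguerre transformation acts on oriented lines, in homogeneous coordinates $(v,w,1,d)$, by a matrix $\begin{pmatrix}\lambda B&0\\ b^T&1\end{pmatrix}$ with $B\in O(2,1)$, $b\in\mathbb R^3$, $\lambda\neq0$; two nets are Laguerre-equivalent if such a transformation takes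 each line of one to the corresponding line of the other. A pencil $\mathcal P$ of quadrics containing $\mathcal Z$ is associated with a checkerboard IC-net if it contains quadrics $\mathcal H,\tilde{\mathcal H}\ne\mathcal Z$ such that $\mathcal H$ contains all the lines $(\ell_{2k+1},\ell_{2k+2})$, $(m_{2k+1},m_{2k+2})$ of $\mathbb R^3$ and $\tilde{\mathcal H}$ contains all the lines $(\ell_{2k},\ell_{2k+1})$, $(m_{2k},m_{2k+1})$, and if the net is in general position in the sense that it determines $\mathcal P$: every quadric through all the points $\ell_i,m_j$ belongs to $\mathcal P$. The common points in $\mathbb R^3$ of all quadrics of $\mathcal P$ form the hypercycle base curve. The pencil, and the net, are generic if no quadric of $\mathcal P$ other than $\mathcal Z$ contains the point at infinity of the axis of $\mathcal Z$. Theorem. A generic checkerboard IC-net is Laguerre-equivalent to a confocal checkerboard IC-net if and only if the hypercycle base curve of the associated pencil of quadrics consists of two non-degenerate loops on the Blaschke cylinder which are either disjoint or transversal. Here a non-degenerate loop is a smooth regular simple closed curve, and two loops are transversal if their tangent lines are different at every common point. -/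

import Mathlib

open scoped ContDiff Matrix

noncomputable section

/-! ### Oriented lines, oriented circles and checkerboard IC-nets -/

/-- The Blaschke cylinder `v² + w² = 1` in `ℝ³`, with coordinates `(v, w, d)`. Its point `(v, w, d)`
is the oriented line `{(x, y) | v x + w y = d}` with unit normal `(v, w)`; the point `(-v, -w, -d)`
is the same line with the opposite orientation. -/
def blaschkeCylinder : Set (Fin 3 → ℝ) := {p | p 0 ^ 2 + p 1 ^ 2 = 1}

/-- Oriented lines of the Euclidean plane. -/
abbrev OrientedLine : Type := blaschkeCylinder

/-- The vector `(v, w, 1)` of an oriented line `(v, w, d)`. -/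
def dirVec (p : Fin 3 → ℝ) : Fin 3 → ℝ := ![p 0, p 1, 1]

/-- The homogeneous coordinates `(v, w, 1, d)` of the point `(v, w, d)` of `ℝ³`. -/
def homVec (p : Fin 3 → ℝ) : Fin 4 → ℝ := ![p 0, p 1, 1, p 2]

/-- The oriented circle with centre `c` and signed radius `r` (a point if `r = 0`) is in oriented
contact with the oriented line `p`. -/
def OrientedContact (c : Fin 2 → ℝ) (r : ℝ) (p : OrientedLine) : Prop :=
  c 0 * p.1 0 + c 1 * p.1 1 - r = p.1 2

/-- Four oriented lines have a common oriented circle in oriented contact. -/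
def HaveCommonCircle (p₁ p₂ p₃ p₄ : OrientedLine) : Prop :=
  ∃ (c : Fin 2 → ℝ) (r : ℝ), OrientedContact c r p₁ ∧ OrientedContact c r p₂ ∧
    OrientedContact c r p₃ ∧ OrientedContact c r p₄

/-- A checkerboard IC-net: two families `l`, `m` of oriented lines such that every second
quadrilateral has an inscribed oriented circle. -/
structure CheckerboardICNet where
  l : ℤ → OrientedLine
  m : ℤ → OrientedLine
  circle_even : ∀ k n : ℤ,
    HaveCommonCircle (l (2 * k)) (l (2 * k + 1)) (m (2 * n)) (m (2 * n + 1))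
  circle_odd : ∀ k n : ℤ,
    HaveCommonCircle (l (2 * k - 1)) (l (2 * k)) (m (2 * n - 1)) (m (2 * n))

/-! ### Laguerre transformations -/

/-- The matrix `diag(1, 1, -1)` of the Lorentz form on `ℝ^{2,1}`. -/
def lorentz : Matrix (Fin 3) (Fin 3) ℝ := Matrix.diagonal ![1, 1, -1]

/-- The data of a Laguerre transformation: the `4 × 4` matrix with block rows `(κ B, 0)` and
`(bᵀ, 1)`, where `B ∈ O(2,1)`, `b ∈ ℝ³` and `κ ≠ 0`, in the homogeneous coordinates
`(v, w, 1, d)`. -/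
structure LaguerreTransformation where
  κ : ℝ
  κ_ne : κ ≠ 0
  B : Matrix (Fin 3) (Fin 3) ℝ
  B_mem : Bᵀ * lorentz * B = lorentz
  b : Fin 3 → ℝ

/-- The Laguerre transformation `T` takes the oriented line `p` to the oriented line `q`, as points
of projective space. -/
def LaguerreTransformation.Maps (T : LaguerreTransformation) (p q : OrientedLine) : Prop :=
  ∃ μ : ℝ, μ ≠ 0 ∧ dirVec q.1 = μ • (T.κ • (T.B *ᵥ dirVec p.1)) ∧
    q.1 2 = μ * (T.b ⬝ᵥ dirVec p.1 + p.1 2)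

/-- Two checkerboard IC-nets are Laguerre-equivalent if a Laguerre transformation takes the lines of
the first one to the lines of the second one. -/
def LaguerreEquivalent (N N' : CheckerboardICNet) : Prop :=
  ∃ T : LaguerreTransformation,
    (∀ i, T.Maps (N.l i) (N'.l i)) ∧ (∀ j, T.Maps (N.m j) (N'.m j))

/-! ### Conics and confocal nets -/

/-- The symmetric matrix `K` is the matrix, in homogeneous coordinates `(x, y, z)` of the plane, of
an ellipse or a hyperbola: the conic is nondegenerate, is not a parabola, and has real points. -/
structure IsEllipseOrHyperbola (K : Matrix (Fin 3) (Fin 3) ℝ) : Prop where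
  symm : K.IsSymm
  det_ne : K.det ≠ 0
  not_parabola : K 0 0 * K 1 1 - K 0 1 ^ 2 ≠ 0
  real_point : ∃ x : Fin 3 → ℝ, x ≠ 0 ∧ x ⬝ᵥ (K *ᵥ x) = 0

/-- The line `p` is the tangent line of the conic `K` at one of its points `x` (in homogeneous
coordinates). The point may lie at infinity, so asymptotes of a hyperbola are tangent lines. -/
def IsTangentToConic (K : Matrix (Fin 3) (Fin 3) ℝ) (p : OrientedLine) : Prop :=
  ∃ x : Fin 3 → ℝ, x ⬝ᵥ (K *ᵥ x) = 0 ∧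
    ∃ μ : ℝ, μ ≠ 0 ∧ K *ᵥ x = μ • ![p.1 0, p.1 1, -p.1 2]

/-- The line `p` passes through the point `f` of the plane. -/
def PassesThrough (p : OrientedLine) (f : Fin 2 → ℝ) : Prop :=
  p.1 0 * f 0 + p.1 1 * f 1 = p.1 2

/-- A checkerboard IC-net is confocal if all its lines are tangent to an ellipse or a hyperbola or,
in the degenerate case of a conic that has collapsed to the segment between its foci (or to the
complement of that segment in its line), if each line passes through one of two distinct points,
the foci. -/
def CheckerboardICNet.IsConfocal (N : CheckerboardICNet) : Prop :=
  (∃ K, IsEllipseOrHyperbola K ∧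
    (∀ i, IsTangentToConic K (N.l i)) ∧ (∀ j, IsTangentToConic K (N.m j))) ∨
  (∃ f g : Fin 2 → ℝ, f ≠ g ∧
    (∀ i, PassesThrough (N.l i) f ∨ PassesThrough (N.l i) g) ∧
    (∀ j, PassesThrough (N.m j) f ∨ PassesThrough (N.m j) g))

/-! ### Pencils of quadrics and hypercycle base curves -/

/-- Quadratic forms in the homogeneous coordinates `(v, w, s, d)`. -/
abbrev QuadForm4 : Type := QuadraticForm ℝ (Fin 4 → ℝ)

/-- The quadratic form `v² + w² - s²` of the Blaschke cylinder. -/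
def blaschkeForm : QuadForm4 := QuadraticMap.weightedSumSquares ℝ (![1, 1, -1, 0] : Fin 4 → ℝ)

/-- A pencil of quadrics containing the Blaschke cylinder. -/
structure IsBlaschkePencil (P : Submodule ℝ QuadForm4) : Prop where
  finrank_eq : Module.finrank ℝ P = 2
  blaschke_mem : blaschkeForm ∈ P

/-- `Q` belongs to the pencil `P` and is a quadric other than the Blaschke cylinder. -/
def IsOtherMember (P : Submodule ℝ QuadForm4) (Q : QuadForm4) : Prop :=
  Q ∈ P ∧ ∀ c : ℝ, Q ≠ c • blaschkeForm

/-- A quadric is generic if it does not contain the point at infinity of the axis of the Blaschke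
cylinder. -/
def IsGenericQuadric (Q : QuadForm4) : Prop := Q ![0, 0, 0, 1] ≠ 0

/-- A pencil containing the Blaschke cylinder is generic if all its other quadrics are generic. -/
def IsGenericPencil (P : Submodule ℝ QuadForm4) : Prop :=
  ∀ Q, IsOtherMember P Q → IsGenericQuadric Q

/-- The quadric `Q` contains the line of `ℝ³` through the points `p` and `q`. -/
def ContainsLine (Q : QuadForm4) (p q : OrientedLine) : Prop :=
  ∀ s t : ℝ, Q (s • homVec p.1 + t • homVec q.1) = 0

/-- `P` is the pencil of quadrics associated with the checkerboard IC-net `N`: it contains the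
Blaschke cylinder and two other quadrics (not necessarily distinct), one through all the lines
`(l (2k+1), l (2k+2))` and `(m (2k+1), m (2k+2))`, the other through all the lines
`(l (2k), l (2k+1))` and `(m (2k), m (2k+1))`; and the net is in general position, in the sense that
it determines the pencil. -/
structure IsAssociatedPencil (N : CheckerboardICNet) (P : Submodule ℝ QuadForm4) : Prop where
  pencil : IsBlaschkePencil P
  odd_quadric : ∃ H, IsOtherMember P H ∧
    (∀ k : ℤ, ContainsLine H (N.l (2 * k + 1)) (N.l (2 * k + 2))) ∧
    (∀ k : ℤ, ContainsLine H (N.m (2 * k + 1)) (N.m (2 * k + 2)))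
  even_quadric : ∃ H, IsOtherMember P H ∧
    (∀ k : ℤ, ContainsLine H (N.l (2 * k)) (N.l (2 * k + 1))) ∧
    (∀ k : ℤ, ContainsLine H (N.m (2 * k)) (N.m (2 * k + 1)))
  determined : ∀ Q : QuadForm4, (∀ i, Q (homVec (N.l i).1) = 0) → (∀ j, Q (homVec (N.m j).1) = 0) →
    Q ∈ P

/-- The base curve of a pencil: the points of `ℝ³` common to all its quadrics. For a pencil that
contains the Blaschke cylinder it lies on the cylinder and is the hypercycle base curve. -/
def baseCurve (P : Submodule ℝ QuadForm4) : Set (Fin 3 → ℝ) := {p | ∀ Q ∈ P, Q (homVec p) = 0}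

/-! ### Loops -/

/-- A non-degenerate loop: a smooth regular simple closed curve, parametrized with period `1`. -/
structure IsNondegenerateLoop (γ : ℝ → Fin 3 → ℝ) : Prop where
  smooth : ContDiff ℝ ∞ γ
  periodic : Function.Periodic γ 1
  regular : ∀ t, deriv γ t ≠ 0
  simple : Set.InjOn γ (Set.Ico 0 1)

/-- Two curves on a surface are transversal: at each common point their tangent directions are
linearly independent. -/
def AreTransversal (γ₁ γ₂ : ℝ → Fin 3 → ℝ) : Prop :=
  ∀ s t, γ₁ s = γ₂ t → LinearIndependent ℝ ![deriv γ₁ s, deriv γ₂ t]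

/-- The set `C` consists of two non-degenerate loops which are disjoint or transversal. -/
def ConsistsOfTwoLoops (C : Set (Fin 3 → ℝ)) : Prop :=
  ∃ γ₁ γ₂ : ℝ → Fin 3 → ℝ, IsNondegenerateLoop γ₁ ∧ IsNondegenerateLoop γ₂ ∧
    C = Set.range γ₁ ∪ Set.range γ₂ ∧
    (Disjoint (Set.range γ₁) (Set.range γ₂) ∨ AreTransversal γ₁ γ₂)

end

/-!
By genericity a quadric of the pencil other than the cylinder has, after completing the square in
`d` and up to a factor, the equation `(d + ⟨b, x⟩)² = F(x)` with `x = (v, w, 1)` and a quadratic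
form `F` on `ℝ^{2,1}`, and it spans the pencil together with the cylinder. A Laguerre transformation
removes `b`, acts on `F` by the Lorentz group, and only the class of `F` modulo the Lorentz form
`v² + w² - s²` matters. So everything is a question about the curves `d² = F(v, w, 1)` on the
cylinder (`cylinderCurve`), up to Lorentz transformations of `F`.

Both sides of the equivalence are compared with a third condition (`IsNormalizable`): some Laguerre
transformation takes all lines of the net to lines with `d² = α v² + β w²`, where `α > 0`.

* Such lines are the tangents of `x² / α + y² / β = 1` or, if `β = 0`, pass through `(± √α, 0)`.
  Conversely the tangents of a conic with a centre, and the lines through two foci, satisfy an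
  equation `(d - ⟨c, n⟩)² = F(n)` with a binary quadratic form `F` of the normal `n`, the equation
  of the dual conic; a translation and a rotation to the principal axes give the normal form. The
  form `F` is positive somewhere, because a net in general position does not lie in a plane `d = 0`
  (`not_liesOn_plane`). This is `exists_confocal_iff`.
* The curve `d² = α v² + β w²` with `α > 0` is parametrized by two loops: two graphs, two plane
  sections, or two ovals (`consistsOfTwoLoops_diagonal`). Laguerre transformations are
  diffeomorphisms of the cylinder, so that this carries over to the base curve.
* For the remaining implication, the pair of `F` and the Lorentz form has a real eigenvector, since
  its characteristic equation is a cubic. According to its causal type, `F` has one of a few normal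
  forms (`exists_normalForm`). Up to the cases with `d = 0` on the whole curve, those other than
  `α v² + β w²` with a positive coefficient give a single oval (complex eigenvalues), or a double
  point at a lightlike eigenvector `(1, 0, 1)`: a node, an isolated point, a cusp or a point of
  contact. In stereographic coordinates `u = w / (1 - v)`, `D = d / (1 - v)`, the complement of the
  double point is an affine conic `D² = a u² + 2 b u + c`.

These curves are excluded by one principle. At a regular point the tangent space of the curve is a
line, so that two disjoint or transversal loops cannot both pass through it; hence a connected piece
of the regular part lies on exactly one of the loops (`subset_or_subset`). A curve which is
connected after removal of at most one singular point is therefore not a union of two loops. At a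
node, each loop would be one of the two branches of the conic `D² = a u² + c`, completed by the node;
it would lie on one side of the plane `w = 0` or `d = 0`, while a regular curve crosses both planes
at the node. At a point of contact both loops have the same tangent. A regular curve cannot pass
through an isolated point.
-/

noncomputable section

/-! ### The action of a Laguerre transformation on the Blaschke cylinder -/

theorem Matrix.dotProduct_congr_mulVec {n : Type*} [Fintype n] (B M : Matrix n n ℝ) (x : n → ℝ) :
    x ⬝ᵥ ((Bᵀ * M * B) *ᵥ x) = (B *ᵥ x) ⬝ᵥ (M *ᵥ (B *ᵥ x)) := by
  rw [← Matrix.mulVec_mulVec, ← Matrix.mulVec_mulVec, Matrix.dotProduct_mulVec,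
    Matrix.vecMul_transpose]

theorem dotProduct_lorentz_mulVec (x : Fin 3 → ℝ) :
    x ⬝ᵥ (lorentz *ᵥ x) = x 0 ^ 2 + x 1 ^ 2 - x 2 ^ 2 := by
  simp [lorentz, dotProduct, Matrix.mulVec_diagonal, Fin.sum_univ_three]
  ring

theorem lorentz_mul_lorentz : lorentz * lorentz = 1 := by
  rw [lorentz, Matrix.diagonal_mul_diagonal, ← Matrix.diagonal_one]
  congr 1
  ext i
  fin_cases i <;> simp

theorem lorentz_transpose : lorentzᵀ = lorentz := Matrix.diagonal_transpose _

section LorentzGroup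

variable {B : Matrix (Fin 3) (Fin 3) ℝ}

theorem lorentz_left_inv (hB : Bᵀ * lorentz * B = lorentz) : lorentz * Bᵀ * lorentz * B = 1 := by
  rw [mul_assoc lorentz, mul_assoc lorentz, hB, lorentz_mul_lorentz]

theorem lorentz_right_inv (hB : Bᵀ * lorentz * B = lorentz) :
    B * (lorentz * Bᵀ * lorentz) = 1 :=
  mul_eq_one_comm.1 (lorentz_left_inv hB)

theorem lorentz_inv_mem (hB : Bᵀ * lorentz * B = lorentz) :
    (lorentz * Bᵀ * lorentz)ᵀ * lorentz * (lorentz * Bᵀ * lorentz) = lorentz := by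
  have h : (lorentz * Bᵀ * lorentz)ᵀ = lorentz * B * lorentz := by
    simp [Matrix.transpose_mul, lorentz_transpose, mul_assoc]
  rw [h]
  calc lorentz * B * lorentz * lorentz * (lorentz * Bᵀ * lorentz)
      = lorentz * B * (lorentz * lorentz) * (lorentz * Bᵀ * lorentz) := by simp only [mul_assoc]
    _ = lorentz * (B * (lorentz * Bᵀ * lorentz)) := by
      rw [lorentz_mul_lorentz, mul_one, mul_assoc]
    _ = lorentz := by rw [lorentz_right_inv hB, mul_one]

theorem lorentz_mul_mem {B' : Matrix (Fin 3) (Fin 3) ℝ} (hB : Bᵀ * lorentz * B = lorentz)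
    (hB' : B'ᵀ * lorentz * B' = lorentz) : (B * B')ᵀ * lorentz * (B * B') = lorentz := by
  calc (B * B')ᵀ * lorentz * (B * B') = B'ᵀ * (Bᵀ * lorentz * B) * B' := by
        simp only [Matrix.transpose_mul, mul_assoc]
    _ = lorentz := by rw [hB, hB']

theorem lorentz_preserves (hB : Bᵀ * lorentz * B = lorentz) (x : Fin 3 → ℝ) :
    (B *ᵥ x) 0 ^ 2 + (B *ᵥ x) 1 ^ 2 - (B *ᵥ x) 2 ^ 2 = x 0 ^ 2 + x 1 ^ 2 - x 2 ^ 2 := by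
  rw [← dotProduct_lorentz_mulVec, ← dotProduct_lorentz_mulVec, ← Matrix.dotProduct_congr_mulVec,
    hB]

end LorentzGroup

theorem mem_blaschkeCylinder {p : Fin 3 → ℝ} :
    p ∈ blaschkeCylinder ↔ p 0 ^ 2 + p 1 ^ 2 = 1 := Iff.rfl

namespace LaguerreTransformation

variable (T : LaguerreTransformation) {p : Fin 3 → ℝ}

/-- The image of the vector `(v, w, 1)` under the linear part of a Laguerre transformation. -/
def dirMap (p : Fin 3 → ℝ) : Fin 3 → ℝ := T.κ • (T.B *ᵥ dirVec p)

/-- The image of the coordinate `d` under a Laguerre transformation, in homogeneous coordinates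
that are not normalized. -/
def distMap (p : Fin 3 → ℝ) : ℝ := T.b ⬝ᵥ dirVec p + p 2

/-- The action of a Laguerre transformation on `ℝ³`, as a projective transformation. The value is
meaningful where the third coordinate of `dirMap` does not vanish, hence on the cylinder. -/
def act (p : Fin 3 → ℝ) : Fin 3 → ℝ :=
  ![T.dirMap p 0 / T.dirMap p 2, T.dirMap p 1 / T.dirMap p 2, T.distMap p / T.dirMap p 2]

/-- The inverse of a Laguerre transformation; the inverse of `B ∈ O(2,1)` is `J Bᵀ J`. -/
def symm : LaguerreTransformation where
  κ := T.κ⁻¹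
  κ_ne := inv_ne_zero T.κ_ne
  B := lorentz * T.Bᵀ * lorentz
  B_mem := lorentz_inv_mem T.B_mem
  b := -(T.κ⁻¹ • (T.b ᵥ* (lorentz * T.Bᵀ * lorentz)))

/-- The composition of two Laguerre transformations: first `T`, then `S`. -/
def trans (S : LaguerreTransformation) : LaguerreTransformation where
  κ := S.κ * T.κ
  κ_ne := mul_ne_zero S.κ_ne T.κ_ne
  B := S.B * T.B
  B_mem := lorentz_mul_mem S.B_mem T.B_mem
  b := T.κ • (S.b ᵥ* T.B) + T.b

theorem dirMap_sq (hp : p ∈ blaschkeCylinder) :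
    T.dirMap p 0 ^ 2 + T.dirMap p 1 ^ 2 = T.dirMap p 2 ^ 2 := by
  have h := lorentz_preserves T.B_mem (dirVec p)
  have hp' : p 0 ^ 2 + p 1 ^ 2 = 1 := hp
  have h2 : dirVec p 0 ^ 2 + dirVec p 1 ^ 2 - dirVec p 2 ^ 2 = 0 := by
    simp [dirVec, hp']
  simp only [dirMap, Pi.smul_apply, smul_eq_mul]
  linear_combination T.κ ^ 2 * h + T.κ ^ 2 * h2

theorem symm_dirMap_aux (p : Fin 3 → ℝ) :
    T.symm.κ • (T.symm.B *ᵥ T.dirMap p) = dirVec p := by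
  simp only [symm, dirMap, Matrix.mulVec_smul, Matrix.mulVec_mulVec]
  rw [lorentz_left_inv T.B_mem, Matrix.one_mulVec, smul_smul, inv_mul_cancel₀ T.κ_ne, one_smul]

theorem dirMap_ne (hp : p ∈ blaschkeCylinder) : T.dirMap p 2 ≠ 0 := by
  intro h
  have h1 := T.dirMap_sq hp
  rw [h] at h1
  have h0 : T.dirMap p = 0 := by
    ext i
    fin_cases i
    · exact pow_eq_zero_iff two_ne_zero |>.1
        (by simp; nlinarith [sq_nonneg (T.dirMap p 0), sq_nonneg (T.dirMap p 1)])
    · exact pow_eq_zero_iff two_ne_zero |>.1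
        (by simp; nlinarith [sq_nonneg (T.dirMap p 0), sq_nonneg (T.dirMap p 1)])
    · exact h
  have h2 := congrFun (T.symm_dirMap_aux p) 2
  rw [h0] at h2
  simp [dirVec] at h2

theorem dirVec_act (h : T.dirMap p 2 ≠ 0) :
    dirVec (T.act p) = (T.dirMap p 2)⁻¹ • T.dirMap p := by
  ext i
  fin_cases i <;> simp [dirVec, act, h, div_eq_inv_mul]

theorem act_two (p : Fin 3 → ℝ) : T.act p 2 = T.distMap p / T.dirMap p 2 := rfl

theorem act_mem (hp : p ∈ blaschkeCylinder) : T.act p ∈ blaschkeCylinder := by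
  have h := T.dirMap_sq hp
  have h2 := T.dirMap_ne hp
  change (T.dirMap p 0 / T.dirMap p 2) ^ 2 + (T.dirMap p 1 / T.dirMap p 2) ^ 2 = 1
  field_simp
  exact h

theorem dirMap_act (S : LaguerreTransformation) (hp : p ∈ blaschkeCylinder) :
    S.dirMap (T.act p) = (T.dirMap p 2)⁻¹ • (T.trans S).dirMap p := by
  simp only [dirMap, trans, T.dirVec_act (T.dirMap_ne hp), Matrix.mulVec_smul,
    Matrix.mulVec_mulVec, smul_smul]
  congr 1
  simp only [Pi.smul_apply]
  ring

theorem distMap_act (S : LaguerreTransformation) (hp : p ∈ blaschkeCylinder) :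
    S.distMap (T.act p) = (T.dirMap p 2)⁻¹ * (T.trans S).distMap p := by
  simp only [distMap, T.dirVec_act (T.dirMap_ne hp), act_two, dotProduct_smul, trans,
    add_dotProduct, smul_dotProduct]
  rw [← Matrix.dotProduct_mulVec]
  simp only [dirMap, dotProduct_smul, smul_eq_mul, Pi.smul_apply]
  ring

theorem act_act (S : LaguerreTransformation) (hp : p ∈ blaschkeCylinder) :
    S.act (T.act p) = (T.trans S).act p := by
  have h := T.dirMap_ne hp
  rw [act, T.dirMap_act S hp, T.distMap_act S hp]
  simp only [Pi.smul_apply, smul_eq_mul]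
  rw [mul_div_mul_left _ _ (inv_ne_zero h), mul_div_mul_left _ _ (inv_ne_zero h),
    mul_div_mul_left _ _ (inv_ne_zero h)]
  rfl

theorem symm_act_act (hp : p ∈ blaschkeCylinder) : T.symm.act (T.act p) = p := by
  rw [T.act_act T.symm hp]
  have h1 : (T.trans T.symm).dirMap p = dirVec p := by
    rw [← T.symm_dirMap_aux p]
    simp only [trans, dirMap, Matrix.mulVec_smul, Matrix.mulVec_mulVec, smul_smul]
  have h2 : (T.trans T.symm).distMap p = p 2 := by
    have : (T.trans T.symm).b = 0 := by
      simp only [trans, symm, Matrix.neg_vecMul, Matrix.smul_vecMul, Matrix.vecMul_vecMul]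
      rw [lorentz_left_inv T.B_mem, Matrix.vecMul_one, smul_neg, smul_smul,
        mul_inv_cancel₀ T.κ_ne, one_smul, neg_add_cancel]
    rw [distMap, this, zero_dotProduct, zero_add]
  ext i
  simp only [act, h1, h2]
  fin_cases i <;> simp [dirVec]

theorem symm_symm_act (hp : p ∈ blaschkeCylinder) : T.act (T.symm.act p) = p := by
  have h1 := T.symm.symm_act_act hp
  have h4 := T.symm_act_act (T.symm.act_mem hp)
  have h5 := T.symm.symm_act_act (T.act_mem (T.symm.act_mem hp))
  rw [h4, h1] at h5
  exact h5.symm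

theorem maps_iff (p q : OrientedLine) : T.Maps p q ↔ q.1 = T.act p.1 := by
  have hne := T.dirMap_ne p.2
  constructor
  · rintro ⟨μ, hμ, h1, h2⟩
    have h1' : dirVec q.1 = μ • T.dirMap p.1 := h1
    have h3 : 1 = μ * T.dirMap p.1 2 := by simpa [dirVec] using congrFun h1' 2
    have hμ' : μ = (T.dirMap p.1 2)⁻¹ := eq_inv_of_mul_eq_one_left h3.symm
    subst hμ'
    ext i
    fin_cases i
    · simpa [dirVec, act, div_eq_inv_mul] using congrFun h1' 0
    · simpa [dirVec, act, div_eq_inv_mul] using congrFun h1' 1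
    · simpa [act, div_eq_inv_mul, distMap] using h2
  · intro h
    refine ⟨(T.dirMap p.1 2)⁻¹, inv_ne_zero hne, ?_, ?_⟩
    · rw [h, T.dirVec_act hne]; rfl
    · rw [h, T.act_two, div_eq_inv_mul]; rfl

theorem contDiffAt_act (h : T.dirMap p 2 ≠ 0) : ContDiffAt ℝ ∞ T.act p := by
  have hdir : ∀ i, ContDiff ℝ ∞ fun p : Fin 3 → ℝ => dirVec p i := by
    intro i
    fin_cases i
    · exact contDiff_apply ℝ ℝ (0 : Fin 3)
    · exact contDiff_apply ℝ ℝ (1 : Fin 3)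
    · exact contDiff_const
  have h1 : ∀ i, ContDiff ℝ ∞ fun p => T.dirMap p i := by
    intro i
    simp only [dirMap, Pi.smul_apply, Matrix.mulVec, dotProduct, smul_eq_mul]
    exact contDiff_const.mul (ContDiff.sum fun j _ => contDiff_const.mul (hdir j))
  have h2 : ContDiff ℝ ∞ T.distMap := by
    unfold distMap
    simp only [dotProduct]
    exact (ContDiff.sum fun j _ => contDiff_const.mul (hdir j)).add
      (contDiff_apply ℝ ℝ (2 : Fin 3))
  rw [contDiffAt_pi]
  intro i
  fin_cases i
  · exact (h1 0).contDiffAt.div (h1 2).contDiffAt h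
  · exact (h1 1).contDiffAt.div (h1 2).contDiffAt h
  · exact h2.contDiffAt.div (h1 2).contDiffAt h

/-- The image of an oriented line under a Laguerre transformation. -/
def actLine (p : OrientedLine) : OrientedLine := ⟨T.act p.1, T.act_mem p.2⟩

/-- Laguerre transformations preserve oriented contact: the lines in oriented contact with a circle
form the section of the cylinder by a plane that does not contain the direction of the axis. -/
theorem exists_orientedContact (c : Fin 2 → ℝ) (r : ℝ) : ∃ (c' : Fin 2 → ℝ) (r' : ℝ),
    ∀ p, OrientedContact c r p → OrientedContact c' r' (T.actLine p) := by
  -- `a` is the covector of the image plane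
  set a : Fin 3 → ℝ := T.κ⁻¹ • ((T.b + ![c 0, c 1, -r]) ᵥ* (lorentz * T.Bᵀ * lorentz)) with ha
  refine ⟨![a 0, a 1], -a 2, fun p hp => ?_⟩
  have hne := T.dirMap_ne p.2
  have h1 : a ⬝ᵥ T.dirMap p.1 = (T.b + ![c 0, c 1, -r]) ⬝ᵥ dirVec p.1 := by
    rw [ha, smul_dotProduct, ← Matrix.dotProduct_mulVec, ← dotProduct_smul]
    congr 1
    exact T.symm_dirMap_aux p.1
  have h2 : a ⬝ᵥ T.dirMap p.1 = T.distMap p.1 := by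
    have hp' : c 0 * p.1 0 + c 1 * p.1 1 - r = p.1 2 := hp
    rw [h1, distMap, add_dotProduct, ← hp']
    simp [dirVec, dotProduct, Fin.sum_univ_three, sub_eq_add_neg]
  have h3 : a 0 * T.dirMap p.1 0 + a 1 * T.dirMap p.1 1 + a 2 * T.dirMap p.1 2
      = T.distMap p.1 := by
    rw [← h2]; simp [dotProduct, Fin.sum_univ_three]
  change a 0 * (T.dirMap p.1 0 / T.dirMap p.1 2) + a 1 * (T.dirMap p.1 1 / T.dirMap p.1 2) - -a 2
    = T.distMap p.1 / T.dirMap p.1 2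
  field_simp
  linarith

theorem haveCommonCircle {p₁ p₂ p₃ p₄ : OrientedLine} (h : HaveCommonCircle p₁ p₂ p₃ p₄) :
    HaveCommonCircle (T.actLine p₁) (T.actLine p₂) (T.actLine p₃) (T.actLine p₄) := by
  obtain ⟨c, r, h1, h2, h3, h4⟩ := h
  obtain ⟨c', r', h⟩ := T.exists_orientedContact c r
  exact ⟨c', r', h _ h1, h _ h2, h _ h3, h _ h4⟩

/-- The image of a checkerboard IC-net under a Laguerre transformation. -/
def actNet (N : CheckerboardICNet) : CheckerboardICNet where
  l i := T.actLine (N.l i)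
  m j := T.actLine (N.m j)
  circle_even k n := T.haveCommonCircle (N.circle_even k n)
  circle_odd k n := T.haveCommonCircle (N.circle_odd k n)

theorem laguerreEquivalent_actNet (N : CheckerboardICNet) : LaguerreEquivalent N (T.actNet N) :=
  ⟨T, fun _ => (T.maps_iff _ _).2 rfl, fun _ => (T.maps_iff _ _).2 rfl⟩

end LaguerreTransformation

/-! ### Transport of loops -/

/-- A smooth map with a differentiable left inverse on `C` takes two loops that are disjoint or
transversal to two such loops. -/
theorem ConsistsOfTwoLoops.image {C : Set (Fin 3 → ℝ)} (hC : ConsistsOfTwoLoops C)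
    {Φ Ψ : (Fin 3 → ℝ) → Fin 3 → ℝ} (hΦ : ∀ p ∈ C, ContDiffAt ℝ ∞ Φ p)
    (hΨ : ∀ p ∈ C, ContDiffAt ℝ ∞ Ψ (Φ p)) (hinv : ∀ p ∈ C, Ψ (Φ p) = p) :
    ConsistsOfTwoLoops (Φ '' C) := by
  obtain ⟨γ₁, γ₂, h1, h2, hCeq, hdt⟩ := hC
  have key : ∀ γ : ℝ → Fin 3 → ℝ, IsNondegenerateLoop γ → (∀ t, γ t ∈ C) →
      IsNondegenerateLoop (Φ ∘ γ) ∧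
        ∀ t, deriv γ t = fderiv ℝ Ψ (Φ (γ t)) (deriv (Φ ∘ γ) t) := by
    intro γ hγ hmem
    have hsm : ContDiff ℝ ∞ (Φ ∘ γ) :=
      contDiff_iff_contDiffAt.2 fun t => (hΦ _ (hmem t)).comp t hγ.smooth.contDiffAt
    have hder : ∀ t, deriv γ t = fderiv ℝ Ψ (Φ (γ t)) (deriv (Φ ∘ γ) t) := by
      intro t
      have hg : γ = Ψ ∘ (Φ ∘ γ) := funext fun s => (hinv _ (hmem s)).symm
      have hd := fderiv_comp_deriv t (f := Φ ∘ γ) (l := Ψ)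
        ((hΨ _ (hmem t)).differentiableAt (by simp))
        ((hsm.differentiable (by simp)) t)
      rw [← hg] at hd
      exact hd
    refine ⟨⟨hsm, fun t => ?_, fun t h0 => ?_, fun s hs t ht hst => ?_⟩, hder⟩
    · simp only [Function.comp_apply]; rw [hγ.periodic t]
    · apply hγ.regular t
      rw [hder t, h0, map_zero]
    · apply hγ.simple hs ht
      rw [← hinv _ (hmem s), ← hinv _ (hmem t)]
      exact congrArg Ψ hst
  have hm1 : ∀ t, γ₁ t ∈ C := fun t => hCeq ▸ Or.inl ⟨t, rfl⟩
  have hm2 : ∀ t, γ₂ t ∈ C := fun t => hCeq ▸ Or.inr ⟨t, rfl⟩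
  obtain ⟨k1, d1⟩ := key γ₁ h1 hm1
  obtain ⟨k2, d2⟩ := key γ₂ h2 hm2
  have hinj : ∀ s t, Φ (γ₁ s) = Φ (γ₂ t) → γ₁ s = γ₂ t := by
    intro s t h
    rw [← hinv _ (hm1 s), ← hinv _ (hm2 t), h]
  refine ⟨Φ ∘ γ₁, Φ ∘ γ₂, k1, k2, ?_, ?_⟩
  · rw [hCeq, Set.image_union, Set.range_comp, Set.range_comp]
  · rcases hdt with hd | ht
    · left
      rw [Set.disjoint_left]
      rintro _ ⟨s, rfl⟩ ⟨t, hst⟩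
      exact Set.disjoint_left.1 hd ⟨s, rfl⟩ ⟨t, (hinj s t hst.symm).symm⟩
    · right
      intro s t hst
      have hli := ht s t (hinj s t hst)
      apply LinearIndependent.of_comp (fderiv ℝ Ψ (Φ (γ₁ s))).toLinearMap
      have hst' : Φ (γ₁ s) = Φ (γ₂ t) := hst
      have hcomp : (fderiv ℝ Ψ (Φ (γ₁ s))).toLinearMap ∘ ![deriv (Φ ∘ γ₁) s, deriv (Φ ∘ γ₂) t] =
          ![deriv γ₁ s, deriv γ₂ t] := by
        ext i : 1
        fin_cases i
        · simp [d1 s]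
        · simp [d2 t, hst']
      rw [hcomp]
      exact hli

/-! ### Generic pencils -/

theorem blaschkeForm_apply (y : Fin 4 → ℝ) :
    blaschkeForm y = y 0 ^ 2 + y 1 ^ 2 - y 2 ^ 2 := by
  simp [blaschkeForm, QuadraticMap.weightedSumSquares_apply, Fin.sum_univ_four]
  ring

theorem blaschkeForm_homVec (p : Fin 3 → ℝ) :
    blaschkeForm (homVec p) = 0 ↔ p ∈ blaschkeCylinder := by
  rw [blaschkeForm_apply, mem_blaschkeCylinder]
  simp [homVec, sub_eq_zero]

section Pencil

variable {N : CheckerboardICNet} {P : Submodule ℝ QuadForm4}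

/-- In a generic pencil, a form that vanishes at the point at infinity of the axis is a multiple of
the form of the cylinder. -/
theorem IsGenericPencil.eq_smul (hgen : IsGenericPencil P) {Q : QuadForm4} (hQ : Q ∈ P)
    (h0 : Q ![0, 0, 0, 1] = 0) : ∃ c : ℝ, Q = c • blaschkeForm := by
  by_contra! h
  exact hgen Q ⟨hQ, h⟩ h0

/-- A generic pencil is spanned by the cylinder and any other quadric of the pencil. -/
theorem IsGenericPencil.mem_baseCurve_iff (hgen : IsGenericPencil P) (hP : IsBlaschkePencil P)
    {Q : QuadForm4} (hQ : Q ∈ P) (h0 : Q ![0, 0, 0, 1] ≠ 0) (p : Fin 3 → ℝ) :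
    p ∈ baseCurve P ↔ p ∈ blaschkeCylinder ∧ Q (homVec p) = 0 := by
  constructor
  · intro h
    exact ⟨(blaschkeForm_homVec p).1 (h _ hP.blaschke_mem), h _ hQ⟩
  · rintro ⟨hZ, hp⟩ R hR
    have hmem : R - (R ![0, 0, 0, 1] / Q ![0, 0, 0, 1]) • Q ∈ P :=
      P.sub_mem hR (P.smul_mem _ hQ)
    obtain ⟨c, hc⟩ := hgen.eq_smul hmem (by simp [h0])
    have h1 := congrArg (fun S : QuadForm4 => S (homVec p)) hc
    simpa [hp, (blaschkeForm_homVec p).2 hZ] using h1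

theorem ContainsLine.left {Q : QuadForm4} {p q : OrientedLine} (h : ContainsLine Q p q) :
    Q (homVec p.1) = 0 := by
  simpa using h 1 0

theorem ContainsLine.right {Q : QuadForm4} {p q : OrientedLine} (h : ContainsLine Q p q) :
    Q (homVec q.1) = 0 := by
  simpa using h 0 1

theorem homVec_eq_zero_of_containsLine {Q : QuadForm4} {l : ℤ → OrientedLine}
    (h : ∀ k : ℤ, ContainsLine Q (l (2 * k + 1)) (l (2 * k + 2))) (i : ℤ) :
    Q (homVec (l i).1) = 0 := by
  rcases Int.even_or_odd' i with ⟨k, rfl | rfl⟩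
  · have h1 := (h (k - 1)).right
    rwa [show 2 * (k - 1) + 2 = 2 * k by ring] at h1
  · exact (h k).left

theorem IsAssociatedPencil.exists_generic (hP : IsAssociatedPencil N P)
    (hgen : IsGenericPencil P) : ∃ Q ∈ P, Q ![0, 0, 0, 1] ≠ 0 ∧
      (∀ i, Q (homVec (N.l i).1) = 0) ∧ ∀ j, Q (homVec (N.m j).1) = 0 := by
  obtain ⟨H, hH, hl, hm⟩ := hP.odd_quadric
  exact ⟨H, hH.1, hgen H hH, homVec_eq_zero_of_containsLine hl, homVec_eq_zero_of_containsLine hm⟩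

/-- The lines of a net in general position are not all in one non-vertical plane `L = 0`: otherwise
the form `v L` would belong to the pencil, but it vanishes at the point at infinity of the axis
without being a multiple of the form of the cylinder. -/
theorem IsAssociatedPencil.not_forall_eq_zero (hP : IsAssociatedPencil N P)
    (hgen : IsGenericPencil P) (L : (Fin 4 → ℝ) →ₗ[ℝ] ℝ) (hL : L ![0, 0, 0, 1] ≠ 0) :
    ¬ ((∀ i, L (homVec (N.l i).1) = 0) ∧ ∀ j, L (homVec (N.m j).1) = 0) := by
  rintro ⟨hl, hm⟩
  set R : QuadForm4 := QuadraticMap.linMulLin (LinearMap.proj 0) L with hR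
  have hmem : R ∈ P := hP.determined R (fun i => by simp [hR, hl i]) (fun j => by simp [hR, hm j])
  obtain ⟨c, hc⟩ := hgen.eq_smul hmem (by simp [hR])
  have key : ∀ y : Fin 4 → ℝ, y 0 * L y = c * (y 0 ^ 2 + y 1 ^ 2 - y 2 ^ 2) := by
    intro y
    have h1 := congrArg (fun S : QuadForm4 => S y) hc
    simpa [hR, blaschkeForm_apply] using h1
  have h1 := key ![1, 0, 0, 0]
  have h2 := key (![1, 0, 0, 0] + ![0, 0, 0, 1])
  rw [map_add] at h2
  simp at h1 h2
  apply hL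
  linarith

end Pencil

/-! ### Curves `d² = F(v, w, 1)` on the cylinder -/

/-- The curve `d² = (v, w, 1) M (v, w, 1)ᵀ` on the Blaschke cylinder. -/
def cylinderCurve (M : Matrix (Fin 3) (Fin 3) ℝ) : Set (Fin 3 → ℝ) :=
  {p | p ∈ blaschkeCylinder ∧ p 2 ^ 2 = dirVec p ⬝ᵥ (M *ᵥ dirVec p)}

/-- Completing the square in the variable `d`. -/
theorem exists_completed_square (Q : QuadForm4) (h0 : Q ![0, 0, 0, 1] ≠ 0) :
    ∃ (b : Fin 3 → ℝ) (M : Matrix (Fin 3) (Fin 3) ℝ), M.IsSymm ∧ ∀ p : Fin 3 → ℝ,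
      Q (homVec p) = Q ![0, 0, 0, 1] *
        ((b ⬝ᵥ dirVec p + p 2) ^ 2 - dirVec p ⬝ᵥ (M *ᵥ dirVec p)) := by
  set e : Fin 4 → ℝ := ![0, 0, 0, 1] with he
  -- the embedding of `ℝ³` into `ℝ⁴` as the hyperplane where the last coordinate vanishes
  set ι : (Fin 3 → ℝ) →ₗ[ℝ] (Fin 4 → ℝ) := LinearMap.pi ![LinearMap.proj 0, LinearMap.proj 1,
    LinearMap.proj 2, 0] with hι
  set b : Fin 3 → ℝ := fun i => QuadraticMap.polar Q (ι (Pi.single i 1)) e / (2 * Q e) with hb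
  have hpol : ∀ x, QuadraticMap.polar Q (ι x) e = 2 * Q e * (b ⬝ᵥ x) := by
    intro x
    have h1 : QuadraticMap.polar Q (ι x) e = (Q.polarBilin.flip e ∘ₗ ι) x := rfl
    rw [h1, LinearMap.pi_apply_eq_sum_univ]
    simp only [dotProduct, Finset.mul_sum]
    refine Finset.sum_congr rfl fun i _ => ?_
    have h2 : (Q.polarBilin.flip e ∘ₗ ι) (fun j => if i = j then 1 else 0) =
        QuadraticMap.polar Q (ι (Pi.single i 1)) e := by
      have : (fun j => if i = j then (1 : ℝ) else 0) = Pi.single i 1 := by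
        ext j; simp [Pi.single_apply, eq_comm]
      rw [this]; rfl
    rw [h2, hb]
    simp only [smul_eq_mul]
    field_simp
  set G : QuadraticForm ℝ (Fin 3 → ℝ) := Q.comp ι with hG
  have hGM : ∀ x, G x = x ⬝ᵥ (G.toMatrix' *ᵥ x) := by
    intro x
    have h1 : G.toMatrix'.toQuadraticForm' = G := by
      rw [Matrix.toQuadraticForm', QuadraticForm.toMatrix', Matrix.toLinearMap₂'_toMatrix']
      exact QuadraticMap.toQuadraticMap_associated ℝ G
    conv_lhs => rw [← h1]
    rw [Matrix.toQuadraticForm', LinearMap.BilinMap.toQuadraticMap_apply,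
      Matrix.toLinearMap₂'_apply']
  refine ⟨b, Matrix.vecMulVec b b - (Q e)⁻¹ • G.toMatrix', ?_, fun p => ?_⟩
  · have h1 := QuadraticForm.isSymm_toMatrix' G
    rw [Matrix.IsSymm] at h1 ⊢
    rw [Matrix.transpose_sub, Matrix.transpose_smul, h1, Matrix.transpose_vecMulVec]
  · have h1 : homVec p = ι (dirVec p) + p 2 • e := by
      ext i
      fin_cases i <;> simp [homVec, hι, dirVec, he]
    have h2 : Q (homVec p) = G (dirVec p) + p 2 ^ 2 * Q e
        + p 2 * QuadraticMap.polar Q (ι (dirVec p)) e := by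
      rw [h1, QuadraticMap.map_add (f := Q), QuadraticMap.polar_smul_right, QuadraticMap.map_smul]
      simp only [hG, QuadraticMap.comp_apply, smul_eq_mul]
      ring
    rw [h2, hpol, hGM, Matrix.sub_mulVec, dotProduct_sub, Matrix.smul_mulVec, dotProduct_smul,
      Matrix.vecMulVec_mulVec]
    simp only [dotProduct_smul, smul_eq_mul, MulOpposite.smul_eq_mul_unop, MulOpposite.unop_op,
      dotProduct_comm (dirVec p) b]
    field_simp
    ring

namespace LaguerreTransformation

variable (T : LaguerreTransformation) {p : Fin 3 → ℝ}

/-- A point lies on the preimage of `cylinderCurve M` under `T.act` if this quadratic equation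
holds. -/
theorem act_mem_cylinderCurve_iff (M : Matrix (Fin 3) (Fin 3) ℝ) (hp : p ∈ blaschkeCylinder) :
    T.act p ∈ cylinderCurve M ↔ T.distMap p ^ 2 = T.dirMap p ⬝ᵥ (M *ᵥ T.dirMap p) := by
  have hne := T.dirMap_ne hp
  have h1 : T.act p ∈ blaschkeCylinder := T.act_mem hp
  rw [cylinderCurve, Set.mem_ofPred_eq, and_iff_right h1, T.dirVec_act hne, Matrix.mulVec_smul,
    dotProduct_smul, smul_dotProduct, T.act_two, smul_eq_mul, smul_eq_mul]
  constructor
  · intro h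
    field_simp at h
    exact h
  · intro h
    field_simp
    exact h

/-- The projection of `ℝ⁴` to the coordinates `(v, w, s)`. -/
def dirProj : (Fin 4 → ℝ) →ₗ[ℝ] (Fin 3 → ℝ) :=
  LinearMap.pi ![LinearMap.proj 0, LinearMap.proj 1, LinearMap.proj 2]

theorem dirProj_homVec (p : Fin 3 → ℝ) : dirProj (homVec p) = dirVec p := by
  ext i
  fin_cases i <;> simp [dirProj, homVec, dirVec]

theorem dirProj_axis : dirProj ![0, 0, 0, 1] = 0 := by
  ext i
  fin_cases i <;> simp [dirProj]

/-- `dirMap` as a linear map in homogeneous coordinates. -/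
def dirLin : (Fin 4 → ℝ) →ₗ[ℝ] (Fin 3 → ℝ) := (T.κ • T.B.mulVecLin) ∘ₗ dirProj

/-- `distMap` as a linear map in homogeneous coordinates. -/
def distLin : (Fin 4 → ℝ) →ₗ[ℝ] ℝ :=
  dotProductBilin ℝ ℝ T.b ∘ₗ dirProj + LinearMap.proj 3

theorem dirLin_homVec (p : Fin 3 → ℝ) : T.dirLin (homVec p) = T.dirMap p := by
  simp [dirLin, dirMap, dirProj_homVec]

theorem distLin_homVec (p : Fin 3 → ℝ) : T.distLin (homVec p) = T.distMap p := by
  have h : homVec p 3 = p 2 := rfl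
  simp [distLin, distMap, dirProj_homVec, h]

theorem distLin_axis : T.distLin ![0, 0, 0, 1] = 1 := by
  simp [distLin, dirProj_axis]

/-- The quadric of the preimage of `cylinderCurve M` under a Laguerre transformation. -/
def curveForm (M : Matrix (Fin 3) (Fin 3) ℝ) : QuadForm4 :=
  QuadraticMap.linMulLin T.distLin T.distLin - M.toQuadraticForm'.comp T.dirLin

theorem curveForm_homVec (M : Matrix (Fin 3) (Fin 3) ℝ) (p : Fin 3 → ℝ) :
    T.curveForm M (homVec p) = T.distMap p ^ 2 - T.dirMap p ⬝ᵥ (M *ᵥ T.dirMap p) := by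
  simp only [curveForm, _root_.sub_apply, QuadraticMap.linMulLin_apply,
    QuadraticMap.comp_apply, T.dirLin_homVec, T.distLin_homVec]
  rw [Matrix.toQuadraticForm', LinearMap.BilinMap.toQuadraticMap_apply,
    Matrix.toLinearMap₂'_apply']
  ring

theorem curveForm_axis (M : Matrix (Fin 3) (Fin 3) ℝ) : T.curveForm M ![0, 0, 0, 1] = 1 := by
  simp [curveForm, T.distLin_axis, dirLin, dirProj_axis]

/-- If the base curve is the preimage of a curve under a Laguerre transformation, then the former
consists of two loops if and only if the latter does. -/
theorem consistsOfTwoLoops_iff {C D : Set (Fin 3 → ℝ)} (hD : D ⊆ blaschkeCylinder)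
    (h : ∀ p, p ∈ C ↔ p ∈ blaschkeCylinder ∧ T.act p ∈ D) :
    ConsistsOfTwoLoops C ↔ ConsistsOfTwoLoops D := by
  have hCD : T.act '' C = D := by
    ext q
    constructor
    · rintro ⟨p, hp, rfl⟩
      exact ((h p).1 hp).2
    · intro hq
      refine ⟨T.symm.act q, (h _).2 ⟨T.symm.act_mem (hD hq), ?_⟩, T.symm_symm_act (hD hq)⟩
      rwa [T.symm_symm_act (hD hq)]
  have hDC : T.symm.act '' D = C := by
    rw [← hCD, Set.image_image]
    have : ∀ p ∈ C, T.symm.act (T.act p) = p := fun p hp => T.symm_act_act ((h p).1 hp).1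
    rw [Set.image_congr this, Set.image_id']
  constructor
  · intro hC
    rw [← hCD]
    refine hC.image (Ψ := T.symm.act) (fun p hp => T.contDiffAt_act (T.dirMap_ne ((h p).1 hp).1))
      (fun p hp => ?_) (fun p hp => T.symm_act_act ((h p).1 hp).1)
    exact T.symm.contDiffAt_act (T.symm.dirMap_ne (T.act_mem ((h p).1 hp).1))
  · intro hC
    rw [← hDC]
    refine hC.image (Ψ := T.act) (fun p hp => T.symm.contDiffAt_act (T.symm.dirMap_ne (hD hp)))
      (fun p hp => ?_) (fun p hp => T.symm_symm_act (hD hp))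
    exact T.contDiffAt_act (T.dirMap_ne (T.symm.act_mem (hD hp)))

end LaguerreTransformation

section Pencil

variable {N : CheckerboardICNet} {P : Submodule ℝ QuadForm4}

/-- All lines of the net, transformed by `T`, lie on a given set. -/
def CheckerboardICNet.LiesOn (N : CheckerboardICNet) (T : LaguerreTransformation)
    (D : Set (Fin 3 → ℝ)) : Prop :=
  (∀ i, T.act (N.l i).1 ∈ D) ∧ ∀ j, T.act (N.m j).1 ∈ D

/-- A curve `d² = F(v, w, 1)` through all lines of a Laguerre-transformed net is the transformed
base curve. -/
theorem IsAssociatedPencil.mem_baseCurve_iff_of_liesOn (hP : IsAssociatedPencil N P)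
    (hgen : IsGenericPencil P) {T : LaguerreTransformation} {M : Matrix (Fin 3) (Fin 3) ℝ}
    (h : N.LiesOn T (cylinderCurve M)) (p : Fin 3 → ℝ) :
    p ∈ baseCurve P ↔ p ∈ blaschkeCylinder ∧ T.act p ∈ cylinderCurve M := by
  have hmem : T.curveForm M ∈ P := by
    apply hP.determined
    · intro i
      rw [T.curveForm_homVec, sub_eq_zero]
      exact (T.act_mem_cylinderCurve_iff M (N.l i).2).1 (h.1 i)
    · intro j
      rw [T.curveForm_homVec, sub_eq_zero]
      exact (T.act_mem_cylinderCurve_iff M (N.m j).2).1 (h.2 j)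
  rw [hgen.mem_baseCurve_iff hP.pencil hmem (by rw [T.curveForm_axis]; exact one_ne_zero)]
  refine and_congr_right fun hp => ?_
  rw [T.curveForm_homVec, sub_eq_zero, T.act_mem_cylinderCurve_iff M hp]

/-- No Laguerre transformation takes all lines of the net to lines with `d = 0`. -/
theorem IsAssociatedPencil.not_liesOn_plane (hP : IsAssociatedPencil N P)
    (hgen : IsGenericPencil P) (T : LaguerreTransformation) : ¬ N.LiesOn T {p | p 2 = 0} := by
  rintro ⟨hl, hm⟩
  have key : ∀ p : OrientedLine, T.act p.1 2 = 0 → T.distLin (homVec p.1) = 0 := by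
    intro p hp
    rw [T.act_two, div_eq_zero_iff, or_iff_left (T.dirMap_ne p.2)] at hp
    rw [T.distLin_homVec, hp]
  exact hP.not_forall_eq_zero hgen T.distLin (by rw [T.distLin_axis]; exact one_ne_zero)
    ⟨fun i => key _ (hl i), fun j => key _ (hm j)⟩

/-- The base curve of a generic pencil is Laguerre-equivalent to a curve `d² = F(v, w, 1)`, and the
form `F` may be changed by a Lorentz transformation and by adding a multiple of the Lorentz form. -/
theorem IsAssociatedPencil.exists_form (hP : IsAssociatedPencil N P) (hgen : IsGenericPencil P) :
    ∃ M : Matrix (Fin 3) (Fin 3) ℝ, M.IsSymm ∧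
      ∀ (B : Matrix (Fin 3) (Fin 3) ℝ) (t : ℝ), Bᵀ * lorentz * B = lorentz →
        ∃ T : LaguerreTransformation, N.LiesOn T (cylinderCurve (Bᵀ * M * B + t • lorentz)) := by
  obtain ⟨Q, hQ, h0, hl, hm⟩ := hP.exists_generic hgen
  obtain ⟨b, M, hM, hQM⟩ := exists_completed_square Q h0
  refine ⟨M, hM, fun B t hB => ?_⟩
  let T : LaguerreTransformation :=
    { κ := 1, κ_ne := one_ne_zero, B := lorentz * Bᵀ * lorentz, B_mem := lorentz_inv_mem hB,
      b := b }
  have key : ∀ p : OrientedLine, Q (homVec p.1) = 0 →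
      T.act p.1 ∈ cylinderCurve (Bᵀ * M * B + t • lorentz) := by
    intro p hp
    rw [hQM, mul_eq_zero, or_iff_right h0, sub_eq_zero] at hp
    rw [T.act_mem_cylinderCurve_iff _ p.2]
    have h1 : B *ᵥ T.dirMap p.1 = dirVec p.1 := by
      simp only [LaguerreTransformation.dirMap, T, one_smul, Matrix.mulVec_mulVec]
      rw [lorentz_right_inv hB, Matrix.one_mulVec]
    rw [Matrix.add_mulVec, dotProduct_add, Matrix.dotProduct_congr_mulVec, h1, ← hp,
      Matrix.smul_mulVec, dotProduct_smul, dotProduct_lorentz_mulVec, T.dirMap_sq p.2]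
    simp [LaguerreTransformation.distMap, T]
  exact ⟨T, fun i => key _ (hl i), fun j => key _ (hm j)⟩

end Pencil

/-! ### Explicit loops -/

open Real in
theorem exists_cos_sin_two_pi {x y : ℝ} (h : x ^ 2 + y ^ 2 = 1) :
    ∃ t : ℝ, cos (2 * π * t) = x ∧ sin (2 * π * t) = y := by
  have hn : ‖(⟨x, y⟩ : ℂ)‖ = 1 := by
    rw [Complex.norm_def, Complex.normSq_mk, ← sq, ← sq, h, Real.sqrt_one]
  have h0 : (⟨x, y⟩ : ℂ) ≠ 0 := by
    intro h0; rw [h0, norm_zero] at hn; exact zero_ne_one hn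
  refine ⟨Complex.arg ⟨x, y⟩ / (2 * π), ?_⟩
  rw [mul_div_cancel₀ _ (by positivity), Complex.cos_arg h0, Complex.sin_arg, hn]
  simp

open Real in
theorem eq_of_cos_sin_two_pi {s t : ℝ} (hs : s ∈ Set.Ico (0 : ℝ) 1) (ht : t ∈ Set.Ico (0 : ℝ) 1)
    (hc : cos (2 * π * s) = cos (2 * π * t)) (hsin : sin (2 * π * s) = sin (2 * π * t)) :
    s = t := by
  obtain ⟨k, hk⟩ := Real.Angle.angle_eq_iff_two_pi_dvd_sub.1 (Real.Angle.cos_sin_inj hc hsin)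
  have h1 : s - t = k := by
    have : 2 * π ≠ 0 := by positivity
    apply mul_left_cancel₀ this
    linarith
  have h2 : (k : ℝ) < 1 := by linarith [hs.2, ht.1]
  have h3 : (-1 : ℝ) < k := by linarith [hs.1, ht.2]
  have h4 : k = 0 := by
    have h2' : k < 1 := by exact_mod_cast h2
    have h3' : -1 < k := by exact_mod_cast h3
    omega
  rw [h4] at h1
  simpa [sub_eq_zero] using h1

theorem deriv_apply_of_differentiable {γ : ℝ → Fin 3 → ℝ} {t : ℝ} (h : DifferentiableAt ℝ γ t)
    (i : Fin 3) : HasDerivAt (fun s => γ s i) (deriv γ t i) t :=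
  hasDerivAt_pi.1 h.hasDerivAt i

open Real in
theorem hasDerivAt_cos_two_pi (a t : ℝ) :
    HasDerivAt (fun t => a * cos (2 * π * t)) (a * (-sin (2 * π * t) * (2 * π))) t := by
  have h : HasDerivAt (fun t : ℝ => 2 * π * t) (2 * π) t := by
    simpa using (hasDerivAt_id t).const_mul (2 * π)
  exact (h.cos).const_mul a

open Real in
theorem hasDerivAt_sin_two_pi (a t : ℝ) :
    HasDerivAt (fun t => a * sin (2 * π * t)) (a * (cos (2 * π * t) * (2 * π))) t := by
  have h : HasDerivAt (fun t : ℝ => 2 * π * t) (2 * π) t := by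
    simpa using (hasDerivAt_id t).const_mul (2 * π)
  exact (h.sin).const_mul a

open Real in
/-- A smooth curve two of whose coordinates describe an ellipse is a non-degenerate loop. -/
theorem isNondegenerateLoop_of_ellipse {γ : ℝ → Fin 3 → ℝ} (i j : Fin 3) {a b : ℝ} (ha : a ≠ 0)
    (hb : b ≠ 0) (hi : ∀ t, γ t i = a * cos (2 * π * t)) (hj : ∀ t, γ t j = b * sin (2 * π * t))
    (hs : ContDiff ℝ ∞ γ) (hp : Function.Periodic γ 1) : IsNondegenerateLoop γ := by
  refine ⟨hs, hp, fun t h0 => ?_, fun s hs t ht hst => ?_⟩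
  · have hd : DifferentiableAt ℝ γ t := (hs.differentiable (by simp)) t
    have h1 := deriv_apply_of_differentiable hd i
    have h2 := deriv_apply_of_differentiable hd j
    rw [h0] at h1 h2
    simp only [hi, hj] at h1 h2
    have e1 := h1.unique (hasDerivAt_cos_two_pi a t)
    have e2 := h2.unique (hasDerivAt_sin_two_pi b t)
    have e1' : sin (2 * π * t) = 0 := by
      simpa [ha, pi_ne_zero] using e1.symm
    have e2' : cos (2 * π * t) = 0 := by
      simpa [hb, pi_ne_zero] using e2.symm
    have := sin_sq_add_cos_sq (2 * π * t)
    rw [e1', e2'] at this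
    norm_num at this
  · apply eq_of_cos_sin_two_pi hs ht
    · apply mul_left_cancel₀ ha
      rw [← hi, ← hi, hst]
    · apply mul_left_cancel₀ hb
      rw [← hj, ← hj, hst]

theorem mem_cylinderCurve_diagonal {α β : ℝ} {p : Fin 3 → ℝ} :
    p ∈ cylinderCurve (Matrix.diagonal ![α, β, 0]) ↔
      p 0 ^ 2 + p 1 ^ 2 = 1 ∧ p 2 ^ 2 = α * p 0 ^ 2 + β * p 1 ^ 2 := by
  rw [cylinderCurve, Set.mem_ofPred_eq, mem_blaschkeCylinder]
  simp only [Matrix.mulVec_diagonal, dotProduct, Fin.sum_univ_three, dirVec]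
  refine and_congr_right fun _ => ?_
  simp
  constructor <;> intro h <;> linear_combination h

open Real in
theorem cos_two_pi_add_one (t : ℝ) : cos (2 * π * (t + 1)) = cos (2 * π * t) := by
  rw [mul_add, mul_one, cos_add_two_pi]

open Real in
theorem sin_two_pi_add_one (t : ℝ) : sin (2 * π * (t + 1)) = sin (2 * π * t) := by
  rw [mul_add, mul_one, sin_add_two_pi]

open Real in
theorem contDiff_cos_two_pi : ContDiff ℝ ∞ fun t : ℝ => cos (2 * π * t) := by fun_prop

open Real in
theorem contDiff_sin_two_pi : ContDiff ℝ ∞ fun t : ℝ => sin (2 * π * t) := by fun_prop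

open Real in
/-- The case of an ellipse: two graphs over the circle. -/
theorem consistsOfTwoLoops_of_pos {α β : ℝ} (hα : 0 < α) (hβ : 0 < β) :
    ConsistsOfTwoLoops (cylinderCurve (Matrix.diagonal ![α, β, 0])) := by
  set f : ℝ → ℝ := fun t => α * cos (2 * π * t) ^ 2 + β * sin (2 * π * t) ^ 2 with hf
  have hpos : ∀ t, 0 < f t := by
    intro t
    have h := sin_sq_add_cos_sq (2 * π * t)
    simp only [hf]
    rcases lt_or_ge α β with h1 | h1
    · nlinarith [sq_nonneg (sin (2 * π * t))]
    · nlinarith [sq_nonneg (cos (2 * π * t))]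
  have hfs : ContDiff ℝ ∞ fun t => √(f t) := by
    have : ContDiff ℝ ∞ f := by simp only [hf]; fun_prop
    exact this.sqrt fun t => (hpos t).ne'
  have hloop : ∀ ε : ℝ, IsNondegenerateLoop
      fun t => ![cos (2 * π * t), sin (2 * π * t), ε * √(f t)] := by
    intro ε
    refine isNondegenerateLoop_of_ellipse 0 1 one_ne_zero one_ne_zero (fun t => by simp)
      (fun t => by simp) ?_ ?_
    · rw [contDiff_pi]
      intro i
      fin_cases i
      · exact contDiff_cos_two_pi
      · exact contDiff_sin_two_pi
      · exact contDiff_const.mul hfs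
    · intro t
      simp only [hf, cos_two_pi_add_one, sin_two_pi_add_one]
  refine ⟨_, _, hloop 1, hloop (-1), ?_, Or.inl ?_⟩
  · ext p
    rw [mem_cylinderCurve_diagonal]
    constructor
    · rintro ⟨h1, h2⟩
      obtain ⟨t, hc, hs⟩ := exists_cos_sin_two_pi h1
      have hft : f t = p 2 ^ 2 := by simp only [hf, hc, hs, h2]
      rcases le_total 0 (p 2) with h | h
      · left
        refine ⟨t, ?_⟩
        simp only [hft, sqrt_sq h, hc, hs]
        ext i; fin_cases i <;> simp
      · right
        refine ⟨t, ?_⟩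
        simp only [hft, sqrt_sq_eq_abs, abs_of_nonpos h, hc, hs]
        ext i; fin_cases i <;> simp
    · rintro (⟨t, rfl⟩ | ⟨t, rfl⟩) <;>
      · refine ⟨by simp [cos_sq_add_sin_sq], ?_⟩
        simpa [hf] using sq_sqrt (hpos t).le
  · rw [Set.disjoint_left]
    rintro _ ⟨s, rfl⟩ ⟨t, hst⟩
    have h := congrFun hst 2
    simp at h
    linarith [sqrt_pos.2 (hpos s), sqrt_pos.2 (hpos t)]

open Real in
/-- The case of two foci: two plane sections of the cylinder, which cross on a ruling. -/
theorem consistsOfTwoLoops_of_foci {α : ℝ} (hα : 0 < α) :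
    ConsistsOfTwoLoops (cylinderCurve (Matrix.diagonal ![α, 0, 0])) := by
  have hsq : √α ≠ 0 := (sqrt_pos.2 hα).ne'
  have hloop : ∀ ε : ℝ, IsNondegenerateLoop
      fun t => ![cos (2 * π * t), sin (2 * π * t), ε * cos (2 * π * t)] := by
    intro ε
    refine isNondegenerateLoop_of_ellipse 0 1 one_ne_zero one_ne_zero (fun t => by simp)
      (fun t => by simp) ?_ ?_
    · rw [contDiff_pi]
      intro i
      fin_cases i
      · exact contDiff_cos_two_pi
      · exact contDiff_sin_two_pi
      · exact contDiff_const.mul contDiff_cos_two_pi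
    · intro t
      simp only [cos_two_pi_add_one, sin_two_pi_add_one]
  have hder : ∀ ε t : ℝ, deriv (fun t => ![cos (2 * π * t), sin (2 * π * t), ε * cos (2 * π * t)]) t
      = ![-sin (2 * π * t) * (2 * π), cos (2 * π * t) * (2 * π),
        ε * (-sin (2 * π * t) * (2 * π))] := by
    intro ε t
    apply HasDerivAt.deriv
    rw [hasDerivAt_pi]
    intro i
    fin_cases i
    · simpa using hasDerivAt_cos_two_pi 1 t
    · simpa using hasDerivAt_sin_two_pi 1 t
    · exact hasDerivAt_cos_two_pi ε t
  refine ⟨_, _, hloop (√α), hloop (-√α), ?_, Or.inr ?_⟩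
  · ext p
    rw [mem_cylinderCurve_diagonal]
    constructor
    · rintro ⟨h1, h2⟩
      obtain ⟨t, hc, hs⟩ := exists_cos_sin_two_pi h1
      have h3 : p 2 ^ 2 = (√α * p 0) ^ 2 := by rw [mul_pow, sq_sqrt hα.le]; linarith
      rcases sq_eq_sq_iff_eq_or_eq_neg.1 h3 with h | h
      · left
        refine ⟨t, ?_⟩
        ext i; fin_cases i <;> simp [hc, hs, h]
      · right
        refine ⟨t, ?_⟩
        ext i; fin_cases i <;> simp [hc, hs, h]
    · rintro (⟨t, rfl⟩ | ⟨t, rfl⟩) <;>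
      · refine ⟨by simp [cos_sq_add_sin_sq], ?_⟩
        simp [mul_pow, sq_sqrt hα.le]
  · intro s t hst
    have h0 : cos (2 * π * s) = cos (2 * π * t) := by simpa using congrFun hst 0
    have h1 : sin (2 * π * s) = sin (2 * π * t) := by simpa using congrFun hst 1
    have h2 : √α * cos (2 * π * s) = -√α * cos (2 * π * t) := by simpa using congrFun hst 2
    have hc : cos (2 * π * t) = 0 := by
      rw [h0] at h2
      have : √α * cos (2 * π * t) = 0 := by linarith
      exact (mul_eq_zero.1 this).resolve_left hsq
    have hsn : sin (2 * π * t) ≠ 0 := by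
      intro h
      have := sin_sq_add_cos_sq (2 * π * t)
      rw [h, hc] at this
      norm_num at this
    rw [hder, hder, h0, h1, hc, LinearIndependent.pair_iff]
    intro x y hxy
    have e0 := congrFun hxy 0
    have e2 := congrFun hxy 2
    simp at e0 e2
    have hk : sin (2 * π * t) * (2 * π) ≠ 0 := mul_ne_zero hsn (by positivity)
    have e0' : x + y = 0 := by
      apply mul_right_cancel₀ hk; linarith
    have e2' : x - y = 0 := by
      apply mul_right_cancel₀ (mul_ne_zero hsq hk); linarith
    constructor <;> linarith

open Real in
/-- The case of a hyperbola: two ovals on opposite sides of the cylinder. -/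
theorem consistsOfTwoLoops_of_neg {α β : ℝ} (hα : 0 < α) (hβ : β < 0) :
    ConsistsOfTwoLoops (cylinderCurve (Matrix.diagonal ![α, β, 0])) := by
  have hαβ : 0 < α - β := by linarith
  set k : ℝ := √(α / (α - β)) with hk
  have hkpos : 0 < k := sqrt_pos.2 (div_pos hα hαβ)
  have hk2 : k ^ 2 = α / (α - β) := sq_sqrt (div_pos hα hαβ).le
  have hk2' : (α - β) * k ^ 2 = α := by rw [hk2]; field_simp
  have hk1 : k ^ 2 < 1 := by rw [hk2, div_lt_one hαβ]; linarith
  have hsq : 0 < √α := sqrt_pos.2 hα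
  set f : ℝ → ℝ := fun t => 1 - (k * sin (2 * π * t)) ^ 2 with hf
  have hpos : ∀ t, 0 < f t := by
    intro t
    have h := sin_sq_le_one (2 * π * t)
    simp only [hf]
    nlinarith [sq_nonneg k]
  have hfs : ContDiff ℝ ∞ fun t => √(f t) := by
    have : ContDiff ℝ ∞ f := by simp only [hf]; fun_prop
    exact this.sqrt fun t => (hpos t).ne'
  have hloop : ∀ ε : ℝ, IsNondegenerateLoop
      fun t => ![ε * √(f t), k * sin (2 * π * t), √α * cos (2 * π * t)] := by
    intro ε
    refine isNondegenerateLoop_of_ellipse 2 1 hsq.ne' hkpos.ne' (fun t => by simp)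
      (fun t => by simp) ?_ ?_
    · rw [contDiff_pi]
      intro i
      fin_cases i
      · exact contDiff_const.mul hfs
      · exact contDiff_const.mul contDiff_sin_two_pi
      · exact contDiff_const.mul contDiff_cos_two_pi
    · intro t
      simp only [hf, cos_two_pi_add_one, sin_two_pi_add_one]
  refine ⟨_, _, hloop 1, hloop (-1), ?_, Or.inl ?_⟩
  · ext p
    rw [mem_cylinderCurve_diagonal]
    constructor
    · rintro ⟨h1, h2⟩
      have h3 : (p 2 / √α) ^ 2 + (p 1 / k) ^ 2 = 1 := by
        rw [div_pow, div_pow, sq_sqrt hα.le, hk2, h2]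
        field_simp
        linear_combination α * h1
      obtain ⟨t, hc, hs⟩ := exists_cos_sin_two_pi h3
      have hc' : √α * cos (2 * π * t) = p 2 := by rw [hc]; field_simp
      have hs' : k * sin (2 * π * t) = p 1 := by rw [hs]; field_simp
      have hft : f t = p 0 ^ 2 := by simp only [hf, hs']; linarith
      rcases le_total 0 (p 0) with h | h
      · left
        refine ⟨t, ?_⟩
        simp only [hft, sqrt_sq h, hc', hs']
        ext i; fin_cases i <;> simp
      · right
        refine ⟨t, ?_⟩
        simp only [hft, sqrt_sq_eq_abs, abs_of_nonpos h, hc', hs']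
        ext i; fin_cases i <;> simp
    · rintro (⟨t, rfl⟩ | ⟨t, rfl⟩) <;>
      · have h1 := cos_sq_add_sin_sq (2 * π * t)
        have h2 : √(f t) ^ 2 = 1 - (k * sin (2 * π * t)) ^ 2 := sq_sqrt (hpos t).le
        refine ⟨by simp only [Matrix.cons_val, mul_pow _ (√(f t)), h2]; ring, ?_⟩
        simp only [Matrix.cons_val, mul_pow, sq_sqrt (hpos t).le, sq_sqrt hα.le]
        simp only [hf]
        linear_combination α * h1 + sin (2 * π * t) ^ 2 * hk2'
  · rw [Set.disjoint_left]
    rintro _ ⟨s, rfl⟩ ⟨t, hst⟩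
    have h := congrFun hst 0
    simp at h
    linarith [sqrt_pos.2 (hpos s), sqrt_pos.2 (hpos t)]

theorem consistsOfTwoLoops_diagonal {α : ℝ} (hα : 0 < α) (β : ℝ) :
    ConsistsOfTwoLoops (cylinderCurve (Matrix.diagonal ![α, β, 0])) := by
  rcases lt_trichotomy β 0 with h | rfl | h
  · exact consistsOfTwoLoops_of_neg hα h
  · exact consistsOfTwoLoops_of_foci hα
  · exact consistsOfTwoLoops_of_pos hα h

/-! ### Confocal nets in normal position -/

/-- Lines with `d² = α v² + β w²`, where `α > 0`, are tangent to the conic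
`x² / α + y² / β = 1` or, if `β = 0`, pass through one of the points `(± √α, 0)`. -/
theorem CheckerboardICNet.isConfocal_of_diagonal {N : CheckerboardICNet} {α : ℝ} (hα : 0 < α)
    (β : ℝ) (hl : ∀ i, (N.l i).1 ∈ cylinderCurve (Matrix.diagonal ![α, β, 0]))
    (hm : ∀ j, (N.m j).1 ∈ cylinderCurve (Matrix.diagonal ![α, β, 0])) : N.IsConfocal := by
  simp only [mem_cylinderCurve_diagonal] at hl hm
  by_cases hβ : β = 0
  · right
    refine ⟨![√α, 0], ![-√α, 0], ?_, ?_⟩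
    · intro h
      have h0 : √α = -√α := congrFun h 0
      linarith [Real.sqrt_pos.2 hα]
    · have key : ∀ p : OrientedLine, p.1 2 ^ 2 = α * p.1 0 ^ 2 + β * p.1 1 ^ 2 →
          PassesThrough p ![√α, 0] ∨ PassesThrough p ![-√α, 0] := by
        intro p hp
        have h3 : p.1 2 ^ 2 = (p.1 0 * √α) ^ 2 := by
          rw [mul_pow, Real.sq_sqrt hα.le, hp, hβ]; ring
        rcases sq_eq_sq_iff_eq_or_eq_neg.1 h3 with h | h
        · left; simp [PassesThrough, h]
        · right; simp [PassesThrough, h]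
      exact ⟨fun i => key _ (hl i).2, fun j => key _ (hm j).2⟩
  · left
    refine ⟨Matrix.diagonal ![α⁻¹, β⁻¹, -1], ⟨Matrix.diagonal_transpose _, ?_, ?_, ?_⟩, ?_⟩
    · simp [Matrix.det_diagonal, Fin.prod_univ_three, hα.ne', hβ]
    · simp [hα.ne', hβ]
    · refine ⟨![√α, 0, 1], fun h => ?_, ?_⟩
      · have := congrFun h 2
        simp at this
      · simp [dotProduct, Matrix.mulVec_diagonal, Fin.sum_univ_three]
        have := Real.mul_self_sqrt hα.le
        field_simp
        linarith
    · have key : ∀ p : OrientedLine, p.1 2 ^ 2 = α * p.1 0 ^ 2 + β * p.1 1 ^ 2 →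
          IsTangentToConic (Matrix.diagonal ![α⁻¹, β⁻¹, -1]) p := by
        intro p hp
        refine ⟨![α * p.1 0, β * p.1 1, p.1 2], ?_, 1, one_ne_zero, ?_⟩
        · simp [dotProduct, Matrix.mulVec_diagonal, Fin.sum_univ_three, hα.ne', hβ]
          linear_combination -hp
        · ext i
          fin_cases i <;> simp [Matrix.mulVec_diagonal, hα.ne', hβ]
      exact ⟨fun i => key _ (hl i).2, fun j => key _ (hm j).2⟩

/-! ### Principal axes of confocal nets -/

/-- Principal axes of a binary quadratic form, by the angle `φ / 2` for the polar angle `φ` of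
`(a - e, 2 b)`. -/
theorem exists_principal_axes (a b e : ℝ) : ∃ c s α β : ℝ, c ^ 2 + s ^ 2 = 1 ∧ β ≤ α ∧
    ∀ v w : ℝ, a * v ^ 2 + 2 * b * v * w + e * w ^ 2 =
      α * (c * v + s * w) ^ 2 + β * (-s * v + c * w) ^ 2 := by
  set z : ℂ := ⟨a - e, 2 * b⟩ with hz
  set φ : ℝ := Complex.arg z with hφ
  have h1 : ‖z‖ * Real.cos φ = a - e := Complex.norm_mul_cos_arg z
  have h2 : ‖z‖ * Real.sin φ = 2 * b := Complex.norm_mul_sin_arg z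
  have hc : Real.cos φ = Real.cos (φ / 2) ^ 2 - Real.sin (φ / 2) ^ 2 := by
    rw [← Real.cos_two_mul']; ring_nf
  have hs : Real.sin φ = 2 * Real.sin (φ / 2) * Real.cos (φ / 2) := by
    rw [← Real.sin_two_mul]; ring_nf
  have h3 := Real.cos_sq_add_sin_sq (φ / 2)
  refine ⟨Real.cos (φ / 2), Real.sin (φ / 2), (a + e + ‖z‖) / 2, (a + e - ‖z‖) / 2, h3,
    by linarith [norm_nonneg z], fun v w => ?_⟩
  rw [hc] at h1
  rw [hs] at h2
  linear_combination (-(v ^ 2 - w ^ 2) / 2) * h1 - v * w * h2 -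
    (a + e) / 2 * (v ^ 2 + w ^ 2) * h3

/-- The rotation matrix about the `s`-axis of `ℝ^{2,1}` that takes `(c, s, 0)` to `(1, 0, 0)`. -/
def rotationMatrix (c s : ℝ) : Matrix (Fin 3) (Fin 3) ℝ := !![c, s, 0; -s, c, 0; 0, 0, 1]

theorem lorentz_eq : lorentz = !![1, 0, 0; 0, 1, 0; 0, 0, -1] := by
  ext i j
  fin_cases i <;> fin_cases j <;> simp [lorentz]

theorem rotationMatrix_mem {c s : ℝ} (h : c ^ 2 + s ^ 2 = 1) :
    (rotationMatrix c s)ᵀ * lorentz * rotationMatrix c s = lorentz := by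
  rw [lorentz_eq]
  ext i j
  fin_cases i <;> fin_cases j <;>
    simp [rotationMatrix, Matrix.mul_apply, Fin.sum_univ_three] <;> linarith

/-- The Laguerre transformation of a translation followed by a rotation. -/
def motion (c s x y : ℝ) (h : c ^ 2 + s ^ 2 = 1) : LaguerreTransformation where
  κ := 1
  κ_ne := one_ne_zero
  B := rotationMatrix c s
  B_mem := rotationMatrix_mem h
  b := ![-x, -y, 0]

theorem motion_act (c s x y : ℝ) (h : c ^ 2 + s ^ 2 = 1) (p : Fin 3 → ℝ) :
    (motion c s x y h).act p =
      ![c * p 0 + s * p 1, -s * p 0 + c * p 1, p 2 - x * p 0 - y * p 1] := by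
  ext i
  fin_cases i <;>
    simp [LaguerreTransformation.act, LaguerreTransformation.dirMap,
      LaguerreTransformation.distMap, motion, rotationMatrix, dirVec, dotProduct,
      Fin.sum_univ_three]
  all_goals ring

section Normal

variable {N : CheckerboardICNet} {P : Submodule ℝ QuadForm4}

/-- A net can be normalized if a Laguerre transformation takes all its lines to lines
`(v, w, d)` with `d² = α v² + β w²`, where `α > 0`. -/
def CheckerboardICNet.IsNormalizable (N : CheckerboardICNet) : Prop :=
  ∃ (T : LaguerreTransformation) (α β : ℝ), 0 < α ∧
    N.LiesOn T (cylinderCurve (Matrix.diagonal ![α, β, 0]))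

theorem CheckerboardICNet.LiesOn.trans {T S : LaguerreTransformation} {C D : Set (Fin 3 → ℝ)}
    (h : N.LiesOn T C) (hS : ∀ p ∈ blaschkeCylinder, p ∈ C → S.act p ∈ D) :
    N.LiesOn (T.trans S) D := by
  constructor
  · intro i
    rw [← T.act_act S (N.l i).2]
    exact hS _ (T.act_mem (N.l i).2) (h.1 i)
  · intro j
    rw [← T.act_act S (N.m j).2]
    exact hS _ (T.act_mem (N.m j).2) (h.2 j)

/-- Principal axes: a curve `(d - ⟨x, n⟩)² = F(n)` with a binary quadratic form `F` of the normal
`n = (v, w)` is put into normal form by a motion; `F` is positive somewhere, since otherwise all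
lines would have `d = 0` in the end. -/
theorem IsAssociatedPencil.isNormalizable_of_binary (hP : IsAssociatedPencil N P)
    (hgen : IsGenericPencil P) {T : LaguerreTransformation} {x y a b e : ℝ}
    (h : N.LiesOn T {q | (q 2 - x * q 0 - y * q 1) ^ 2 =
      a * q 0 ^ 2 + 2 * b * q 0 * q 1 + e * q 1 ^ 2}) : N.IsNormalizable := by
  obtain ⟨c, s, α, β, hcs, hβα, hF⟩ := exists_principal_axes a b e
  have hlies : N.LiesOn (T.trans (motion c s x y hcs))
      (cylinderCurve (Matrix.diagonal ![α, β, 0])) := by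
    refine h.trans fun p hp hpC => ?_
    have hpC' : (p 2 - x * p 0 - y * p 1) ^ 2 =
      a * p 0 ^ 2 + 2 * b * p 0 * p 1 + e * p 1 ^ 2 := hpC
    have hmem := (motion c s x y hcs).act_mem hp
    rw [mem_blaschkeCylinder] at hmem
    rw [mem_cylinderCurve_diagonal, and_iff_right hmem, motion_act]
    simpa [hF] using hpC'
  refine ⟨_, α, β, ?_, hlies⟩
  by_contra hα
  have key : cylinderCurve (Matrix.diagonal ![α, β, 0]) ⊆ {p | p 2 = 0} := by
    intro p hp
    rw [mem_cylinderCurve_diagonal] at hp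
    have h1 : p 2 ^ 2 ≤ 0 := by
      rw [hp.2]; nlinarith [sq_nonneg (p 0), sq_nonneg (p 1)]
    exact pow_eq_zero_iff two_ne_zero |>.1 (le_antisymm h1 (sq_nonneg _))
  exact hP.not_liesOn_plane hgen _ ⟨fun i => key (hlies.1 i), fun j => key (hlies.2 j)⟩

/-- A tangent line of a conic satisfies the equation of the dual conic, given by the adjugate
matrix. -/
theorem IsTangentToConic.dual {K : Matrix (Fin 3) (Fin 3) ℝ} {p : OrientedLine}
    (h : IsTangentToConic K p) :
    ![p.1 0, p.1 1, -p.1 2] ⬝ᵥ (K.adjugate *ᵥ ![p.1 0, p.1 1, -p.1 2]) = 0 := by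
  obtain ⟨x, hx, μ, hμ, hKx⟩ := h
  have h1 : ![p.1 0, p.1 1, -p.1 2] = μ⁻¹ • (K *ᵥ x) := by
    rw [hKx, smul_smul, inv_mul_cancel₀ hμ, one_smul]
  rw [h1, Matrix.mulVec_smul, Matrix.mulVec_mulVec, Matrix.adjugate_mul, Matrix.smul_mulVec,
    Matrix.one_mulVec, dotProduct_smul, dotProduct_smul, smul_dotProduct, dotProduct_comm, hx]
  simp

/-- The lines of a confocal net satisfy an equation `(d - ⟨c, n⟩)² = F(n)`, where `c` is the
common centre of the conics. -/
theorem CheckerboardICNet.IsConfocal.exists_binary (h : N.IsConfocal) : ∃ x y a b e : ℝ,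
    ∀ q : OrientedLine, (q ∈ Set.range N.l ∨ q ∈ Set.range N.m) →
      (q.1 2 - x * q.1 0 - y * q.1 1) ^ 2 =
        a * q.1 0 ^ 2 + 2 * b * q.1 0 * q.1 1 + e * q.1 1 ^ 2 := by
  rcases h with ⟨K, hK, hl, hm⟩ | ⟨f, g, -, hl, hm⟩
  · set A := K.adjugate with hA
    have hδ : A 2 2 ≠ 0 := by
      have h10 : K 1 0 = K 0 1 := hK.symm.apply 0 1
      have := hK.not_parabola
      rw [hA, Matrix.adjugate_fin_three]
      simp only [Matrix.of_apply, Matrix.cons_val]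
      rw [h10, ← sq]
      exact this
    have hsymm : A.IsSymm := by
      rw [Matrix.IsSymm, hA, Matrix.adjugate_transpose, hK.symm]
    have h10 : A 1 0 = A 0 1 := hsymm.apply 0 1
    have h20 : A 2 0 = A 0 2 := hsymm.apply 0 2
    have h21 : A 2 1 = A 1 2 := hsymm.apply 1 2
    refine ⟨A 0 2 / A 2 2, A 1 2 / A 2 2, (A 0 2 / A 2 2) ^ 2 - A 0 0 / A 2 2,
      A 0 2 / A 2 2 * (A 1 2 / A 2 2) - A 0 1 / A 2 2, (A 1 2 / A 2 2) ^ 2 - A 1 1 / A 2 2,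
      fun q hq => ?_⟩
    have hq' : IsTangentToConic K q := by
      rcases hq with ⟨i, rfl⟩ | ⟨j, rfl⟩
      · exact hl i
      · exact hm j
    have hd := hq'.dual
    rw [← hA] at hd
    simp only [dotProduct, Matrix.mulVec, Fin.sum_univ_three, Matrix.cons_val, h10, h20, h21] at hd
    field_simp
    linear_combination A 2 2 * hd
  · refine ⟨(f 0 + g 0) / 2, (f 1 + g 1) / 2, ((f 0 - g 0) / 2) ^ 2,
      (f 0 - g 0) / 2 * ((f 1 - g 1) / 2), ((f 1 - g 1) / 2) ^ 2, fun q hq => ?_⟩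
    have hq' : PassesThrough q f ∨ PassesThrough q g := by
      rcases hq with ⟨i, rfl⟩ | ⟨j, rfl⟩
      · exact hl i
      · exact hm j
    have h0 : (q.1 0 * f 0 + q.1 1 * f 1 - q.1 2) * (q.1 0 * g 0 + q.1 1 * g 1 - q.1 2) = 0 := by
      rw [mul_eq_zero, sub_eq_zero, sub_eq_zero]
      exact hq'
    linear_combination h0

/-- A net is Laguerre-equivalent to a confocal one if and only if it can be normalized. -/
theorem IsAssociatedPencil.exists_confocal_iff (hP : IsAssociatedPencil N P)
    (hgen : IsGenericPencil P) :
    (∃ N' : CheckerboardICNet, N'.IsConfocal ∧ LaguerreEquivalent N N') ↔ N.IsNormalizable := by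
  constructor
  · rintro ⟨N', hN', T, hl, hm⟩
    obtain ⟨x, y, a, b, e, h⟩ := hN'.exists_binary
    refine hP.isNormalizable_of_binary hgen (T := T) (x := x) (y := y) (a := a) (b := b) (e := e)
      ⟨fun i => ?_, fun j => ?_⟩
    · rw [← (T.maps_iff _ _).1 (hl i)]
      exact h _ (Or.inl ⟨i, rfl⟩)
    · rw [← (T.maps_iff _ _).1 (hm j)]
      exact h _ (Or.inr ⟨j, rfl⟩)
  · rintro ⟨T, α, β, hα, hl, hm⟩
    exact ⟨T.actNet N, CheckerboardICNet.isConfocal_of_diagonal hα β hl hm,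
      T.laguerreEquivalent_actNet N⟩

/-- The base curve of the pencil of a net that can be normalized consists of two loops. -/
theorem IsAssociatedPencil.consistsOfTwoLoops (hP : IsAssociatedPencil N P)
    (hgen : IsGenericPencil P) (h : N.IsNormalizable) : ConsistsOfTwoLoops (baseCurve P) := by
  obtain ⟨T, α, β, hα, h⟩ := h
  rw [T.consistsOfTwoLoops_iff (fun p hp => hp.1) (hP.mem_baseCurve_iff_of_liesOn hgen h)]
  exact consistsOfTwoLoops_diagonal hα β

end Normal

/-! ### Normal forms of quadratic forms on `ℝ^{2,1}` -/

/-- Two symmetric matrices are congruent if a Lorentz transformation takes the quadratic form of the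
first one to that of the second one, up to a multiple of the Lorentz form. -/
def LorentzCongruent (M M' : Matrix (Fin 3) (Fin 3) ℝ) : Prop :=
  ∃ (B : Matrix (Fin 3) (Fin 3) ℝ) (t : ℝ), Bᵀ * lorentz * B = lorentz ∧
    M' = Bᵀ * M * B + t • lorentz

namespace LorentzCongruent

variable {M M' M'' : Matrix (Fin 3) (Fin 3) ℝ}

theorem trans (h : LorentzCongruent M M') (h' : LorentzCongruent M' M'') :
    LorentzCongruent M M'' := by
  obtain ⟨B, t, hB, rfl⟩ := h
  obtain ⟨B', t', hB', rfl⟩ := h'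
  refine ⟨B * B', t + t', lorentz_mul_mem hB hB', ?_⟩
  rw [mul_add, add_mul, mul_smul_comm, smul_mul_assoc, hB', Matrix.transpose_mul, add_smul]
  simp only [mul_assoc, add_assoc]

theorem add_smul (M : Matrix (Fin 3) (Fin 3) ℝ) (t : ℝ) :
    LorentzCongruent M (M + t • lorentz) :=
  ⟨1, t, by simp, by simp⟩

theorem isSymm (h : LorentzCongruent M M') (hM : M.IsSymm) : M'.IsSymm := by
  obtain ⟨B, t, hB, rfl⟩ := h
  rw [Matrix.IsSymm, Matrix.transpose_add, Matrix.transpose_smul, lorentz_transpose,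
    Matrix.transpose_mul, Matrix.transpose_mul, Matrix.transpose_transpose, hM, mul_assoc]

/-- An eigenvector of the pair `(M, lorentz)` can be moved into the kernel of the form. -/
theorem of_eigenvector {B : Matrix (Fin 3) (Fin 3) ℝ} (hB : Bᵀ * lorentz * B = lorentz)
    {u e : Fin 3 → ℝ} {k μ : ℝ} (hu : M *ᵥ u = μ • (lorentz *ᵥ u)) (he : B *ᵥ e = k • u) :
    ∃ M', LorentzCongruent M M' ∧ M' *ᵥ e = 0 := by
  refine ⟨_, ⟨B, -μ, hB, rfl⟩, ?_⟩
  have h1 : (Bᵀ * M * B + (-μ) • lorentz) = Bᵀ * (M - μ • lorentz) * B := by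
    rw [mul_sub, sub_mul, mul_smul_comm, smul_mul_assoc, hB, neg_smul, sub_eq_add_neg]
  rw [h1, ← Matrix.mulVec_mulVec, he, ← Matrix.mulVec_mulVec, Matrix.mulVec_smul,
    Matrix.sub_mulVec, hu, Matrix.smul_mulVec, sub_self, smul_zero, Matrix.mulVec_zero]

end LorentzCongruent

theorem exists_cubic_root (a b c : ℝ) : ∃ x : ℝ, x ^ 3 + a * x ^ 2 + b * x + c = 0 := by
  set R : ℝ := 1 + |a| + |b| + |c| with hR
  have ha := abs_nonneg a
  have hb := abs_nonneg b
  have hc := abs_nonneg c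
  have hR1 : 1 ≤ R := by linarith
  have hR2 : R ≤ R ^ 2 := by nlinarith
  have e1 : |a| * R ^ 2 + |b| * R + |c| ≤ (R - 1) * R ^ 2 := by
    have h1 : |b| * R ≤ |b| * R ^ 2 := mul_le_mul_of_nonneg_left hR2 hb
    have h2 : |c| * 1 ≤ |c| * R ^ 2 := mul_le_mul_of_nonneg_left (hR1.trans hR2) hc
    have h3 : (R - 1) * R ^ 2 = |a| * R ^ 2 + |b| * R ^ 2 + |c| * R ^ 2 := by rw [hR]; ring
    linarith
  have hcont : Continuous fun x : ℝ => x ^ 3 + a * x ^ 2 + b * x + c := by fun_prop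
  have hbR1 := mul_le_mul_of_nonneg_right (neg_abs_le b) (zero_le_one.trans hR1)
  have hbR2 := mul_le_mul_of_nonneg_right (le_abs_self b) (zero_le_one.trans hR1)
  have haR1 := mul_le_mul_of_nonneg_right (neg_abs_le a) (sq_nonneg R)
  have haR2 := mul_le_mul_of_nonneg_right (le_abs_self a) (sq_nonneg R)
  have hpos : 0 ≤ R ^ 3 + a * R ^ 2 + b * R + c := by
    nlinarith [neg_abs_le c]
  have hneg : (-R) ^ 3 + a * (-R) ^ 2 + b * (-R) + c ≤ 0 := by
    nlinarith [le_abs_self c]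
  obtain ⟨x, hx⟩ := mem_range_of_exists_le_of_exists_ge hcont ⟨-R, hneg⟩ ⟨R, hpos⟩
  exact ⟨x, hx⟩

/-- A symmetric matrix has an eigenvector with respect to the Lorentz form: the characteristic
equation is a cubic. -/
theorem exists_lorentz_eigenvector (M : Matrix (Fin 3) (Fin 3) ℝ) :
    ∃ (u : Fin 3 → ℝ) (μ : ℝ), u ≠ 0 ∧ M *ᵥ u = μ • (lorentz *ᵥ u) := by
  obtain ⟨x, hx⟩ : ∃ x : ℝ, (M - x • lorentz).det = 0 := by
    obtain ⟨x, hx⟩ := exists_cubic_root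
      (M 2 2 - M 0 0 - M 1 1)
      (M 0 0 * M 1 1 - M 0 1 * M 1 0 - M 0 0 * M 2 2 + M 0 2 * M 2 0 - M 1 1 * M 2 2
        + M 1 2 * M 2 1)
      M.det
    refine ⟨x, ?_⟩
    rw [Matrix.det_fin_three] at hx
    rw [Matrix.det_fin_three, lorentz_eq]
    simp
    linear_combination hx
  obtain ⟨u, hu, h⟩ := Matrix.exists_mulVec_eq_zero_iff.2 hx
  refine ⟨u, x, hu, ?_⟩
  rwa [Matrix.sub_mulVec, sub_eq_zero, Matrix.smul_mulVec] at h

/-- The Lorentz boost in the `(v, s)`-plane. -/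
def boostMatrix (c s : ℝ) : Matrix (Fin 3) (Fin 3) ℝ := !![c, 0, s; 0, 1, 0; s, 0, c]

/-- The Lorentz boost in the `(w, s)`-plane. -/
def boostMatrix' (c s : ℝ) : Matrix (Fin 3) (Fin 3) ℝ := !![1, 0, 0; 0, c, s; 0, s, c]

/-- The parabolic Lorentz transformation that fixes the lightlike vector `(1, 0, 1)`. -/
def nullRotation (τ : ℝ) : Matrix (Fin 3) (Fin 3) ℝ :=
  !![1 - τ ^ 2 / 2, τ, τ ^ 2 / 2; -τ, 1, τ; -τ ^ 2 / 2, τ, 1 + τ ^ 2 / 2]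

theorem boostMatrix_mem {c s : ℝ} (h : c ^ 2 - s ^ 2 = 1) :
    (boostMatrix c s)ᵀ * lorentz * boostMatrix c s = lorentz := by
  rw [lorentz_eq]
  ext i j
  fin_cases i <;> fin_cases j <;>
    simp [boostMatrix, Matrix.mul_apply, Fin.sum_univ_three] <;> linarith

theorem boostMatrix'_mem {c s : ℝ} (h : c ^ 2 - s ^ 2 = 1) :
    (boostMatrix' c s)ᵀ * lorentz * boostMatrix' c s = lorentz := by
  rw [lorentz_eq]
  ext i j
  fin_cases i <;> fin_cases j <;>
    simp [boostMatrix', Matrix.mul_apply, Fin.sum_univ_three] <;> linarith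

theorem nullRotation_mem (τ : ℝ) :
    (nullRotation τ)ᵀ * lorentz * nullRotation τ = lorentz := by
  rw [lorentz_eq]
  ext i j
  fin_cases i <;> fin_cases j <;>
    simp [nullRotation, Matrix.mul_apply, Fin.sum_univ_three] <;> ring

theorem exists_polar (x y : ℝ) : ∃ ρ c s : ℝ, c ^ 2 + s ^ 2 = 1 ∧ x = ρ * c ∧ y = ρ * s :=
  ⟨‖(⟨x, y⟩ : ℂ)‖, Real.cos (Complex.arg ⟨x, y⟩), Real.sin (Complex.arg ⟨x, y⟩),
    Real.cos_sq_add_sin_sq _, (Complex.norm_mul_cos_arg ⟨x, y⟩).symm,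
    (Complex.norm_mul_sin_arg ⟨x, y⟩).symm⟩

theorem exists_lorentz_of_timelike {u : Fin 3 → ℝ} (h : u 0 ^ 2 + u 1 ^ 2 < u 2 ^ 2) :
    ∃ (B : Matrix (Fin 3) (Fin 3) ℝ) (k : ℝ), Bᵀ * lorentz * B = lorentz ∧
      B *ᵥ ![0, 0, 1] = k • u := by
  obtain ⟨ρ, c, s, hcs, h0, h1⟩ := exists_polar (u 0) (u 1)
  have hρ : ρ ^ 2 < u 2 ^ 2 := by
    have : ρ ^ 2 = u 0 ^ 2 + u 1 ^ 2 := by rw [h0, h1]; linear_combination -ρ ^ 2 * hcs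
    linarith
  set n := √(u 2 ^ 2 - ρ ^ 2) with hn
  have hn0 : n ≠ 0 := (Real.sqrt_pos.2 (by linarith)).ne'
  have hn2 : n ^ 2 = u 2 ^ 2 - ρ ^ 2 := Real.sq_sqrt (by linarith)
  refine ⟨rotationMatrix c (-s) * boostMatrix (u 2 / n) (ρ / n), n⁻¹,
    lorentz_mul_mem (rotationMatrix_mem (by linarith)) (boostMatrix_mem ?_), ?_⟩
  · field_simp; linarith
  · rw [← Matrix.mulVec_mulVec]
    ext i
    fin_cases i <;>
      simp [rotationMatrix, boostMatrix, Matrix.mulVec, dotProduct, Fin.sum_univ_three, h0, h1] <;>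
      ring

theorem exists_lorentz_of_spacelike {u : Fin 3 → ℝ} (h : u 2 ^ 2 < u 0 ^ 2 + u 1 ^ 2) :
    ∃ (B : Matrix (Fin 3) (Fin 3) ℝ) (k : ℝ), Bᵀ * lorentz * B = lorentz ∧
      B *ᵥ ![0, 1, 0] = k • u := by
  obtain ⟨ρ, c, s, hcs, h0, h1⟩ := exists_polar (u 0) (u 1)
  have hρ : u 2 ^ 2 < ρ ^ 2 := by
    have : ρ ^ 2 = u 0 ^ 2 + u 1 ^ 2 := by rw [h0, h1]; linear_combination -ρ ^ 2 * hcs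
    linarith
  set n := √(ρ ^ 2 - u 2 ^ 2) with hn
  have hn0 : n ≠ 0 := (Real.sqrt_pos.2 (by linarith)).ne'
  have hn2 : n ^ 2 = ρ ^ 2 - u 2 ^ 2 := Real.sq_sqrt (by linarith)
  refine ⟨rotationMatrix s c * boostMatrix' (ρ / n) (u 2 / n), n⁻¹,
    lorentz_mul_mem (rotationMatrix_mem (by linarith)) (boostMatrix'_mem ?_), ?_⟩
  · field_simp; linarith
  · rw [← Matrix.mulVec_mulVec]
    ext i
    fin_cases i <;>
      simp [rotationMatrix, boostMatrix', Matrix.mulVec, dotProduct, Fin.sum_univ_three, h0, h1] <;>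
      ring

theorem exists_lorentz_of_lightlike {u : Fin 3 → ℝ} (hu : u ≠ 0)
    (h : u 0 ^ 2 + u 1 ^ 2 = u 2 ^ 2) :
    ∃ (B : Matrix (Fin 3) (Fin 3) ℝ) (k : ℝ), Bᵀ * lorentz * B = lorentz ∧
      B *ᵥ ![1, 0, 1] = k • u := by
  have h2 : u 2 ≠ 0 := by
    intro h2
    apply hu
    rw [h2] at h
    ext i
    fin_cases i
    · exact pow_eq_zero_iff two_ne_zero |>.1
        (by simp; nlinarith [sq_nonneg (u 0), sq_nonneg (u 1)])
    · exact pow_eq_zero_iff two_ne_zero |>.1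
        (by simp; nlinarith [sq_nonneg (u 0), sq_nonneg (u 1)])
    · exact h2
  refine ⟨rotationMatrix (u 0 / u 2) (-(u 1 / u 2)), (u 2)⁻¹, rotationMatrix_mem ?_, ?_⟩
  · field_simp; linarith
  · ext i
    fin_cases i <;>
      simp [rotationMatrix, Matrix.mulVec, dotProduct, Fin.sum_univ_three, h2] <;> ring

section NormalForms

variable {M : Matrix (Fin 3) (Fin 3) ℝ}

theorem lorentzCongruent_of_timelike (hM : M.IsSymm) {u : Fin 3 → ℝ} {μ : ℝ}
    (hu : M *ᵥ u = μ • (lorentz *ᵥ u)) (h : u 0 ^ 2 + u 1 ^ 2 < u 2 ^ 2) :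
    ∃ a b e : ℝ, LorentzCongruent M !![a, b, 0; b, e, 0; 0, 0, 0] := by
  obtain ⟨B, k, hB, he⟩ := exists_lorentz_of_timelike h
  obtain ⟨M', hMM', h0⟩ := LorentzCongruent.of_eigenvector hB hu he
  have hs := hMM'.isSymm hM
  refine ⟨M' 0 0, M' 0 1, M' 1 1, ?_⟩
  convert hMM' using 1
  have e1 : ∀ i, M' i 2 = 0 := by
    intro i
    have := congrFun h0 i
    simpa [Matrix.mulVec, dotProduct, Fin.sum_univ_three] using this
  have e2 : ∀ i, M' 2 i = 0 := fun i => by rw [← hs.apply, e1]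
  ext i j
  fin_cases i <;> fin_cases j <;> simp [e1, e2, hs.apply 0 1]

theorem lorentzCongruent_of_spacelike (hM : M.IsSymm) {u : Fin 3 → ℝ} {μ : ℝ}
    (hu : M *ᵥ u = μ • (lorentz *ᵥ u)) (h : u 2 ^ 2 < u 0 ^ 2 + u 1 ^ 2) :
    ∃ c q r : ℝ, LorentzCongruent M !![0, 0, q; 0, c, 0; q, 0, r] := by
  obtain ⟨B, k, hB, he⟩ := exists_lorentz_of_spacelike h
  obtain ⟨M', hMM', h0⟩ := LorentzCongruent.of_eigenvector hB hu he
  have hs := hMM'.isSymm hM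
  refine ⟨-M' 0 0, M' 0 2, M' 2 2 + M' 0 0, ?_⟩
  convert hMM'.trans (LorentzCongruent.add_smul M' (-M' 0 0)) using 1
  have e1 : ∀ i, M' i 1 = 0 := by
    intro i
    have := congrFun h0 i
    simpa [Matrix.mulVec, dotProduct, Fin.sum_univ_three] using this
  have e2 : ∀ i, M' 1 i = 0 := fun i => by rw [← hs.apply, e1]
  rw [lorentz_eq]
  ext i j
  fin_cases i <;> fin_cases j <;> simp [e1, e2, hs.apply 0 2]

/-- The matrix of the quadratic form `a w² + 2 b w (s - v) + c (s - v)²`, which is singular at the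
lightlike vector `(1, 0, 1)`. -/
def parabolicMatrix (a b c : ℝ) : Matrix (Fin 3) (Fin 3) ℝ :=
  !![c, -b, -c; -b, a, b; -c, b, c]

theorem lorentzCongruent_of_lightlike (hM : M.IsSymm) {u : Fin 3 → ℝ} {μ : ℝ} (hu0 : u ≠ 0)
    (hu : M *ᵥ u = μ • (lorentz *ᵥ u)) (h : u 0 ^ 2 + u 1 ^ 2 = u 2 ^ 2) :
    ∃ a b c : ℝ, LorentzCongruent M (parabolicMatrix a b c) := by
  obtain ⟨B, k, hB, he⟩ := exists_lorentz_of_lightlike hu0 h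
  obtain ⟨M', hMM', h0⟩ := LorentzCongruent.of_eigenvector hB hu he
  have hs := hMM'.isSymm hM
  refine ⟨M' 1 1, M' 1 2, M' 2 2, ?_⟩
  convert hMM' using 1
  have e1 : ∀ i, M' i 0 + M' i 2 = 0 := by
    intro i
    have := congrFun h0 i
    simpa [Matrix.mulVec, dotProduct, Fin.sum_univ_three] using this
  have h0 := e1 0
  have h1 := e1 1
  have h2 := e1 2
  have s1 := hs.apply 0 1
  have s2 := hs.apply 0 2
  have s3 := hs.apply 1 2
  ext i j
  fin_cases i <;> fin_cases j <;> simp [parabolicMatrix] <;> linarith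

/-- A null rotation completes the square in `w`. -/
theorem parabolicMatrix_congruent {a : ℝ} (ha : a ≠ 0) (b c : ℝ) :
    LorentzCongruent (parabolicMatrix a b c) (parabolicMatrix a 0 (c - b ^ 2 / a)) := by
  refine ⟨nullRotation (-b / a), 0, nullRotation_mem _, ?_⟩
  ext i j
  fin_cases i <;> fin_cases j <;>
    simp [parabolicMatrix, nullRotation, Matrix.mul_apply, Fin.sum_univ_three] <;>
    field_simp <;> ring

/-- Classification of quadratic forms on `ℝ^{2,1}`, up to congruence, by an eigenvector with respect
to the Lorentz form: there is a timelike eigenvector, or a spacelike one whose orthogonal complement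
contains no eigenvector, or a lightlike one. -/
theorem exists_normalForm (hM : M.IsSymm) :
    (∃ a b e : ℝ, LorentzCongruent M !![a, b, 0; b, e, 0; 0, 0, 0]) ∨
    (∃ c q r : ℝ, |r| < 2 * q ∧ LorentzCongruent M !![0, 0, q; 0, c, 0; q, 0, r]) ∨
    (∃ a c : ℝ, a ≠ 0 ∧ c ≠ 0 ∧ LorentzCongruent M (parabolicMatrix a 0 c)) ∨
    (∃ b c : ℝ, LorentzCongruent M (parabolicMatrix 0 b c)) := by
  -- the lightlike case, for every matrix congruent to `M`
  have light : ∀ M', LorentzCongruent M M' → ∀ (u : Fin 3 → ℝ) (μ : ℝ), u ≠ 0 →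
      M' *ᵥ u = μ • (lorentz *ᵥ u) → u 0 ^ 2 + u 1 ^ 2 = u 2 ^ 2 →
      (∃ a b e : ℝ, LorentzCongruent M !![a, b, 0; b, e, 0; 0, 0, 0]) ∨
      (∃ a c : ℝ, a ≠ 0 ∧ c ≠ 0 ∧ LorentzCongruent M (parabolicMatrix a 0 c)) ∨
      (∃ b c : ℝ, LorentzCongruent M (parabolicMatrix 0 b c)) := by
    intro M' hMM' u μ hu0 hu h
    obtain ⟨a, b, c, h1⟩ := lorentzCongruent_of_lightlike (hMM'.isSymm hM) hu0 hu h
    have h2 := hMM'.trans h1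
    by_cases ha : a = 0
    · subst ha
      exact Or.inr (Or.inr ⟨b, c, h2⟩)
    · have h3 := h2.trans (parabolicMatrix_congruent ha b c)
      by_cases hc : c - b ^ 2 / a = 0
      · left
        refine ⟨0, 0, a, ?_⟩
        rw [hc] at h3
        convert h3 using 1
        simp [parabolicMatrix]
      · exact Or.inr (Or.inl ⟨a, _, ha, hc, h3⟩)
  obtain ⟨u, μ, hu0, hu⟩ := exists_lorentz_eigenvector M
  rcases lt_trichotomy (u 0 ^ 2 + u 1 ^ 2) (u 2 ^ 2) with h | h | h
  · exact Or.inl (lorentzCongruent_of_timelike hM hu h)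
  · have := light M (by simpa using LorentzCongruent.add_smul M 0) u μ hu0 hu h
    exact this.imp_right Or.inr
  obtain ⟨c, q, r, hcong⟩ := lorentzCongruent_of_spacelike hM hu h
  by_cases hqr : |r| < 2 * |q|
  · refine Or.inr (Or.inl ⟨c, |q|, r, hqr, ?_⟩)
    rcases le_total 0 q with hq | hq
    · rwa [abs_of_nonneg hq]
    · -- the half-turn changes the sign of `q`
      refine hcong.trans ⟨rotationMatrix (-1) 0, 0, rotationMatrix_mem (by norm_num), ?_⟩
      rw [abs_of_nonpos hq]
      ext i j
      fin_cases i <;> fin_cases j <;>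
        simp [rotationMatrix, Matrix.mul_apply, Fin.sum_univ_three]
  push Not at hqr
  by_cases hq : q = 0
  · left
    refine ⟨r, 0, c + r, ?_⟩
    convert hcong.trans (LorentzCongruent.add_smul _ r) using 1
    rw [lorentz_eq, hq]
    ext i j
    fin_cases i <;> fin_cases j <;> simp
  -- the restriction to the `(v, s)`-plane has the eigenvector `(q, x)`, for the root `x` of
  -- larger modulus of the characteristic equation
  obtain ⟨x, hx, hqx⟩ : ∃ x : ℝ, x ^ 2 + r * x + q ^ 2 = 0 ∧ q ^ 2 ≤ x ^ 2 := by
    have hD : 0 ≤ r ^ 2 - 4 * q ^ 2 := by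
      have := pow_le_pow_left₀ (by positivity) hqr 2
      rw [mul_pow, sq_abs, sq_abs] at this
      linarith
    have hsq := Real.sq_sqrt hD
    set S := √(r ^ 2 - 4 * q ^ 2) with hS
    have hS0 : 0 ≤ S := Real.sqrt_nonneg _
    rcases le_total 0 r with hr | hr
    · refine ⟨-(r + S) / 2, by linear_combination hsq / 4, ?_⟩
      nlinarith [mul_nonneg hr hS0]
    · refine ⟨(-r + S) / 2, by linear_combination hsq / 4, ?_⟩
      nlinarith [mul_nonneg (neg_nonneg.2 hr) hS0]
  have hev : !![0, 0, q; 0, c, 0; q, 0, r] *ᵥ ![q, 0, x] = x • (lorentz *ᵥ ![q, 0, x]) := by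
    rw [lorentz_eq]
    ext i
    fin_cases i <;> simp [Matrix.mulVec, dotProduct, Fin.sum_univ_three]
    · ring
    · linear_combination hx
  rcases hqx.lt_or_eq with hlt | heq
  · left
    obtain ⟨a, b, e, h1⟩ := lorentzCongruent_of_timelike (hcong.isSymm hM) hev (by simpa using hlt)
    exact ⟨a, b, e, hcong.trans h1⟩
  · have := light _ hcong _ x (fun h0 => hq (by simpa using congrFun h0 0)) hev (by simpa using heq)
    exact this.imp_right Or.inr

end NormalForms

/-! ### Tangents of loops on a curve `d² = F(v, w, 1)` -/

section Tangents

variable {M : Matrix (Fin 3) (Fin 3) ℝ} {γ γ₁ γ₂ : ℝ → Fin 3 → ℝ} {p : Fin 3 → ℝ}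

/-- A point `p` at which the gradients of the two equations of `cylinderCurve M` are linearly
independent: either `d ≠ 0`, or the derivative of `F` along the circle does not vanish. -/
def IsRegularPoint (M : Matrix (Fin 3) (Fin 3) ℝ) (p : Fin 3 → ℝ) : Prop :=
  p 2 ≠ 0 ∨ p 0 * (M *ᵥ dirVec p) 1 - p 1 * (M *ᵥ dirVec p) 0 ≠ 0

/-- Two loops with union `C` that are disjoint or transversal. -/
structure IsLoopPair (C : Set (Fin 3 → ℝ)) (γ₁ γ₂ : ℝ → Fin 3 → ℝ) : Prop where
  left : IsNondegenerateLoop γ₁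
  right : IsNondegenerateLoop γ₂
  union : C = Set.range γ₁ ∪ Set.range γ₂
  position : Disjoint (Set.range γ₁) (Set.range γ₂) ∨ AreTransversal γ₁ γ₂

theorem ConsistsOfTwoLoops.exists_loopPair {C : Set (Fin 3 → ℝ)} (h : ConsistsOfTwoLoops C) :
    ∃ γ₁ γ₂, IsLoopPair C γ₁ γ₂ := by
  obtain ⟨γ₁, γ₂, h1, h2, h3, h4⟩ := h
  exact ⟨γ₁, γ₂, h1, h2, h3, h4⟩

namespace IsLoopPair

variable {C : Set (Fin 3 → ℝ)}

theorem symm (h : IsLoopPair C γ₁ γ₂) : IsLoopPair C γ₂ γ₁ :=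
  ⟨h.right, h.left, by rw [h.union, Set.union_comm], h.position.imp (fun hd => hd.symm)
    fun ht s t hst => LinearIndependent.pair_symm_iff.1 (ht t s hst.symm)⟩

theorem left_mem (h : IsLoopPair C γ₁ γ₂) (t : ℝ) : γ₁ t ∈ C := by
  rw [h.union]; exact Or.inl ⟨t, rfl⟩

theorem right_mem (h : IsLoopPair C γ₁ γ₂) (t : ℝ) : γ₂ t ∈ C := h.symm.left_mem t

theorem mem (h : IsLoopPair C γ₁ γ₂) (hp : p ∈ C) : p ∈ Set.range γ₁ ∨ p ∈ Set.range γ₂ := by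
  rwa [h.union] at hp

theorem linearIndependent (h : IsLoopPair C γ₁ γ₂) {s t : ℝ} (hst : γ₁ s = γ₂ t) :
    LinearIndependent ℝ ![deriv γ₁ s, deriv γ₂ t] := by
  rcases h.position with hd | ht
  · exact absurd ⟨t, hst.symm⟩ (Set.disjoint_left.1 hd ⟨s, rfl⟩)
  · exact ht s t hst

end IsLoopPair

theorem IsNondegenerateLoop.hasDerivAt (hγ : IsNondegenerateLoop γ) (t : ℝ) (i : Fin 3) :
    HasDerivAt (fun s => γ s i) (deriv γ t i) t :=
  deriv_apply_of_differentiable ((hγ.smooth.differentiable (by simp)) t) i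

theorem IsNondegenerateLoop.isClosed_range (hγ : IsNondegenerateLoop γ) :
    IsClosed (Set.range γ) :=
  (hγ.periodic.compact_of_continuous one_ne_zero hγ.smooth.continuous).isClosed

theorem IsNondegenerateLoop.not_subset_singleton (hγ : IsNondegenerateLoop γ) (p : Fin 3 → ℝ) :
    ¬ ∀ t, γ t = p := by
  intro h
  have : (0 : ℝ) = 1 / 2 :=
    hγ.simple (by norm_num) (by norm_num) ((h 0).trans (h (1 / 2)).symm)
  norm_num at this

/-- The tangent vector of a curve on the cylinder. -/
theorem IsNondegenerateLoop.deriv_circle (hγ : IsNondegenerateLoop γ)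
    (h : ∀ t, γ t ∈ blaschkeCylinder) (t : ℝ) :
    γ t 0 * deriv γ t 0 + γ t 1 * deriv γ t 1 = 0 := by
  have h1 := ((hγ.hasDerivAt t 0).mul (hγ.hasDerivAt t 0)).add
    ((hγ.hasDerivAt t 1).mul (hγ.hasDerivAt t 1))
  have h2 : (fun s => γ s 0) * (fun s => γ s 0) + (fun s => γ s 1) * (fun s => γ s 1) =
      fun _ => (1 : ℝ) := by
    funext s
    have := mem_blaschkeCylinder.1 (h s)
    simp only [Pi.add_apply, Pi.mul_apply]
    linarith
  rw [h2] at h1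
  have := h1.unique (hasDerivAt_const t (1 : ℝ))
  linarith

/-- The tangent vector of a curve on `cylinderCurve M`. -/
theorem IsNondegenerateLoop.deriv_curve (hγ : IsNondegenerateLoop γ) (hM : M.IsSymm)
    (h : ∀ t, γ t ∈ cylinderCurve M) (t : ℝ) : γ t 2 * deriv γ t 2 =
      (M *ᵥ dirVec (γ t)) 0 * deriv γ t 0 + (M *ᵥ dirVec (γ t)) 1 * deriv γ t 1 := by
  have e : ∀ s, γ s 2 * γ s 2 = M 0 0 * (γ s 0 * γ s 0) + M 1 1 * (γ s 1 * γ s 1) +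
      2 * M 0 1 * (γ s 0 * γ s 1) + 2 * M 0 2 * γ s 0 + 2 * M 1 2 * γ s 1 + M 2 2 := by
    intro s
    have h1 := (h s).2
    have s1 := hM.apply 0 1
    have s2 := hM.apply 0 2
    have s3 := hM.apply 1 2
    simp [dirVec, Matrix.mulVec, dotProduct, Fin.sum_univ_three, s1, s2, s3] at h1
    linear_combination h1
  have d0 := hγ.hasDerivAt t 0
  have d1 := hγ.hasDerivAt t 1
  have d2 := hγ.hasDerivAt t 2
  have hl := d2.mul d2
  have hr := ((((((d0.mul d0).const_mul (M 0 0)).add ((d1.mul d1).const_mul (M 1 1))).add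
    ((d0.mul d1).const_mul (2 * M 0 1))).add (d0.const_mul (2 * M 0 2))).add
    (d1.const_mul (2 * M 1 2))).add (hasDerivAt_const t (M 2 2))
  have hEq := hl.unique (hr.congr_of_eventuallyEq (Filter.Eventually.of_forall fun s => by
    simpa using e s))
  have s1 := hM.apply 0 1
  simp [dirVec, Matrix.mulVec, dotProduct, Fin.sum_univ_three, s1]
  linarith

/-- At a regular point, the tangent space of the curve is at most one-dimensional. -/
theorem IsRegularPoint.not_linearIndependent (hp : p ∈ blaschkeCylinder)
    (hreg : IsRegularPoint M p) {X Y : Fin 3 → ℝ}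
    (hX : p 0 * X 0 + p 1 * X 1 = 0) (hY : p 0 * Y 0 + p 1 * Y 1 = 0)
    (hX' : p 2 * X 2 = (M *ᵥ dirVec p) 0 * X 0 + (M *ᵥ dirVec p) 1 * X 1)
    (hY' : p 2 * Y 2 = (M *ᵥ dirVec p) 0 * Y 0 + (M *ᵥ dirVec p) 1 * Y 1) :
    ¬ LinearIndependent ℝ ![X, Y] := by
  intro hli
  rw [mem_blaschkeCylinder] at hp
  rw [LinearIndependent.pair_iff] at hli
  have hX0 : X ≠ 0 := by
    rintro rfl
    exact one_ne_zero (hli 1 0 (by simp)).1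
  unfold IsRegularPoint at hreg
  set g := M *ᵥ dirVec p with hg
  -- `a` and `b` are the components of `X` and `Y` in the direction of the circle
  set a := p 0 * X 1 - p 1 * X 0 with ha
  set b := p 0 * Y 1 - p 1 * Y 0 with hb
  have x0 : X 0 = -p 1 * a := by rw [ha]; linear_combination p 0 * hX - X 0 * hp
  have x1 : X 1 = p 0 * a := by rw [ha]; linear_combination p 1 * hX - X 1 * hp
  have y0 : Y 0 = -p 1 * b := by rw [hb]; linear_combination p 0 * hY - Y 0 * hp
  have y1 : Y 1 = p 0 * b := by rw [hb]; linear_combination p 1 * hY - Y 1 * hp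
  have x2 : p 2 * X 2 = a * (p 0 * g 1 - p 1 * g 0) := by rw [hX', x0, x1]; ring
  have y2 : p 2 * Y 2 = b * (p 0 * g 1 - p 1 * g 0) := by rw [hY', y0, y1]; ring
  by_cases h2 : p 2 = 0
  · have hreg' := hreg.resolve_left (not_not_intro h2)
    have ha0 : a = 0 := by
      rw [h2, zero_mul] at x2
      exact (mul_eq_zero.1 x2.symm).resolve_right hreg'
    have hb0 : b = 0 := by
      rw [h2, zero_mul] at y2
      exact (mul_eq_zero.1 y2.symm).resolve_right hreg'
    have := hli (Y 2) (-X 2) (by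
      ext i
      fin_cases i
      · simp [x0, y0, ha0, hb0]
      · simp [x1, y1, ha0, hb0]
      · simp; ring)
    apply hX0
    ext i
    fin_cases i
    · simp [x0, ha0]
    · simp [x1, ha0]
    · simpa using this.2
  · have h3 : b * X 2 + -a * Y 2 = 0 :=
      mul_left_cancel₀ h2 (by linear_combination b * x2 - a * y2)
    have := hli b (-a) (by
      ext i
      fin_cases i
      · simp [x0, y0]; ring
      · simp [x1, y1]; ring
      · simpa using h3)
    have ha0 : a = 0 := neg_eq_zero.1 this.2
    apply hX0
    ext i
    fin_cases i
    · simp [x0, ha0]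
    · simp [x1, ha0]
    · rw [ha0, zero_mul] at x2
      exact (mul_eq_zero.1 x2).resolve_left h2

theorem IsLoopPair.not_common (h : IsLoopPair (cylinderCurve M) γ₁ γ₂) (hM : M.IsSymm)
    (hreg : IsRegularPoint M p) (h1 : p ∈ Set.range γ₁) (h2 : p ∈ Set.range γ₂) : False := by
  obtain ⟨s, rfl⟩ := h1
  obtain ⟨t, ht⟩ := h2
  have e1 := h.left.deriv_circle (fun t => (h.left_mem t).1) s
  have e2 := h.right.deriv_circle (fun t => (h.right_mem t).1) t
  have e3 := h.left.deriv_curve hM h.left_mem s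
  have e4 := h.right.deriv_curve hM h.right_mem t
  rw [ht] at e2 e4
  exact hreg.not_linearIndependent (h.left_mem s).1 e1 e2 e3 e4 (h.linearIndependent ht.symm)

/-- A connected piece of the regular part of the curve lies on only one of the loops. -/
theorem IsLoopPair.subset_or_subset (h : IsLoopPair (cylinderCurve M) γ₁ γ₂) (hM : M.IsSymm)
    {S : Set (Fin 3 → ℝ)} (hS : IsPreconnected S) (hSC : S ⊆ cylinderCurve M)
    (hreg : ∀ p ∈ S, IsRegularPoint M p) :
    (∀ t, γ₂ t ∉ S) ∨ ∀ t, γ₁ t ∉ S := by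
  have key := isPreconnected_iff_subset_of_disjoint_closed.1 hS _ _ h.left.isClosed_range
    h.right.isClosed_range (h.union ▸ hSC) (by
      rw [Set.eq_empty_iff_forall_notMem]
      rintro p ⟨hp, h1, h2⟩
      exact h.not_common hM (hreg p hp) h1 h2)
  rcases key with h1 | h2
  · exact Or.inl fun t ht => h.not_common hM (hreg _ ht) (h1 ht) ⟨t, rfl⟩
  · exact Or.inr fun t ht => h.not_common hM (hreg _ ht) ⟨t, rfl⟩ (h2 ht)

/-- A curve that is connected and regular up to one point is not the union of two loops. -/
theorem not_consistsOfTwoLoops_of_isPreconnected (hM : M.IsSymm) {S : Set (Fin 3 → ℝ)}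
    (hS : IsPreconnected S) (hSC : S ⊆ cylinderCurve M) (hreg : ∀ p ∈ S, IsRegularPoint M p)
    (p₀ : Fin 3 → ℝ) (hCS : ∀ p ∈ cylinderCurve M, p ∈ S ∨ p = p₀) :
    ¬ ConsistsOfTwoLoops (cylinderCurve M) := by
  intro h
  obtain ⟨γ₁, γ₂, h⟩ := h.exists_loopPair
  rcases h.subset_or_subset hM hS hSC hreg with h1 | h1
  · exact h.right.not_subset_singleton p₀ fun t =>
      (hCS _ (h.right_mem t)).resolve_left (h1 t)
  · exact h.left.not_subset_singleton p₀ fun t =>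
      (hCS _ (h.left_mem t)).resolve_left (h1 t)

/-- If a curve consists of two connected regular pieces and one point, then two loops can only be
these pieces, each completed by the point. -/
theorem ConsistsOfTwoLoops.exists_of_pieces (h : ConsistsOfTwoLoops (cylinderCurve M))
    (hM : M.IsSymm) {S₁ S₂ : Set (Fin 3 → ℝ)} (hS₁ : IsPreconnected S₁) (hS₂ : IsPreconnected S₂)
    (hSC₁ : S₁ ⊆ cylinderCurve M) (hSC₂ : S₂ ⊆ cylinderCurve M)
    (hreg₁ : ∀ p ∈ S₁, IsRegularPoint M p) (hreg₂ : ∀ p ∈ S₂, IsRegularPoint M p)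
    (p₀ : Fin 3 → ℝ) (hCS : ∀ p ∈ cylinderCurve M, p ∈ S₁ ∨ p ∈ S₂ ∨ p = p₀) :
    ∃ γ₁ γ₂, IsLoopPair (cylinderCurve M) γ₁ γ₂ ∧ (∀ t, γ₁ t ∈ S₁ ∨ γ₁ t = p₀) ∧
      ∀ t, γ₂ t ∈ S₂ ∨ γ₂ t = p₀ := by
  obtain ⟨γ₁, γ₂, h⟩ := h.exists_loopPair
  rcases h.subset_or_subset hM hS₁ hSC₁ hreg₁ with h1 | h1 <;>
    rcases h.subset_or_subset hM hS₂ hSC₂ hreg₂ with h2 | h2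
  · refine absurd (fun t => ?_) (h.right.not_subset_singleton p₀)
    have := hCS _ (h.right_mem t); have := h1 t; have := h2 t
    tauto
  · refine ⟨γ₁, γ₂, h, fun t => ?_, fun t => ?_⟩
    · have := hCS _ (h.left_mem t); have := h2 t
      tauto
    · have := hCS _ (h.right_mem t); have := h1 t
      tauto
  · refine ⟨γ₂, γ₁, h.symm, fun t => ?_, fun t => ?_⟩
    · have := hCS _ (h.right_mem t); have := h2 t
      tauto
    · have := hCS _ (h.left_mem t); have := h1 t
      tauto
  · refine absurd (fun t => ?_) (h.left.not_subset_singleton p₀)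
    have := hCS _ (h.left_mem t); have := h1 t; have := h2 t
    tauto

end Tangents

/-! ### A single oval -/

theorem dirVec_zero (p : Fin 3 → ℝ) : dirVec p 0 = p 0 := rfl
theorem dirVec_one (p : Fin 3 → ℝ) : dirVec p 1 = p 1 := rfl
theorem dirVec_two (p : Fin 3 → ℝ) : dirVec p 2 = 1 := rfl

theorem mulVec_dirVec (M : Matrix (Fin 3) (Fin 3) ℝ) (p : Fin 3 → ℝ) (i : Fin 3) :
    (M *ᵥ dirVec p) i = M i 0 * p 0 + M i 1 * p 1 + M i 2 := by
  simp [Matrix.mulVec, dotProduct, Fin.sum_univ_three, dirVec]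

theorem mem_cylinderCurve_iff {M : Matrix (Fin 3) (Fin 3) ℝ} {p : Fin 3 → ℝ} :
    p ∈ cylinderCurve M ↔ p 0 ^ 2 + p 1 ^ 2 = 1 ∧ p 2 ^ 2 =
      p 0 * (M 0 0 * p 0 + M 0 1 * p 1 + M 0 2) + p 1 * (M 1 0 * p 0 + M 1 1 * p 1 + M 1 2) +
        (M 2 0 * p 0 + M 2 1 * p 1 + M 2 2) := by
  rw [cylinderCurve, Set.mem_ofPred_eq, mem_blaschkeCylinder]
  simp only [dotProduct, Fin.sum_univ_three, mulVec_dirVec, dirVec_zero, dirVec_one, dirVec_two,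
    one_mul]

theorem mem_cylinderCurve_oval {c q r : ℝ} {p : Fin 3 → ℝ} :
    p ∈ cylinderCurve !![0, 0, q; 0, c, 0; q, 0, r] ↔
      p 0 ^ 2 + p 1 ^ 2 = 1 ∧ p 2 ^ 2 = c * p 1 ^ 2 + 2 * q * p 0 + r := by
  rw [mem_cylinderCurve_iff]
  refine and_congr_right fun _ => ?_
  simp
  constructor <;> intro h <;> linear_combination h

open Real in
/-- The curve `d² = c w² + 2 q v + r` is a single oval: on the interval `[-1, 1]`, the right-hand
side, as a quadratic polynomial in `v`, has exactly one zero `v₀`, which is simple. -/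
theorem not_consistsOfTwoLoops_oval {c q r : ℝ} (h : |r| < 2 * q) :
    ¬ ConsistsOfTwoLoops (cylinderCurve !![0, 0, q; 0, c, 0; q, 0, r]) := by
  obtain ⟨hr1, hr2⟩ := abs_lt.1 h
  have hq : 0 < q := by linarith
  have hM : (!![0, 0, q; 0, c, 0; q, 0, r] : Matrix (Fin 3) (Fin 3) ℝ).IsSymm := by
    ext i j
    fin_cases i <;> fin_cases j <;> rfl
  obtain ⟨v₀, ⟨hv1, hv2⟩, hv⟩ : ∃ v ∈ Set.Icc (-1 : ℝ) 1, c * (1 - v ^ 2) + 2 * q * v + r = 0 := by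
    have hcont : ContinuousOn (fun v : ℝ => c * (1 - v ^ 2) + 2 * q * v + r) (Set.Icc (-1) 1) := by
      fun_prop
    exact intermediate_value_Icc (by norm_num) hcont
      ⟨by norm_num; linarith, by norm_num; linarith⟩
  have hv1' : -1 < v₀ := by
    refine lt_of_le_of_ne hv1 fun h0 => ?_
    rw [← h0] at hv; norm_num at hv; linarith
  have hv2' : v₀ < 1 := by
    refine lt_of_le_of_ne hv2 fun h0 => ?_
    rw [h0] at hv; norm_num at hv; linarith
  -- the complementary linear factor is positive on `[-1, 1]`
  have hL1 : 0 < 2 * q - c * (1 + v₀) := by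
    have : 0 < (1 - v₀) * (2 * q - c * (1 + v₀)) := by
      have : (1 - v₀) * (2 * q - c * (1 + v₀)) = 2 * q + r := by linear_combination -hv
      linarith
    exact pos_of_mul_pos_right this (by linarith)
  have hL2 : 0 < 2 * q - c * (-1 + v₀) := by
    have : 0 < (1 + v₀) * (2 * q - c * (-1 + v₀)) := by
      have : (1 + v₀) * (2 * q - c * (-1 + v₀)) = 2 * q - r := by linear_combination hv
      linarith
    exact pos_of_mul_pos_right this (by linarith)
  have hL : ∀ v : ℝ, -1 ≤ v → v ≤ 1 → 0 < 2 * q - c * (v + v₀) := by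
    intro v h1 h2
    rcases le_total 0 c with hc | hc <;> nlinarith
  have hfac : ∀ v : ℝ, c * (1 - v ^ 2) + 2 * q * v + r = (v - v₀) * (2 * q - c * (v + v₀)) := by
    intro v; linear_combination hv
  -- a parametrization of the oval
  set V : ℝ → ℝ := fun ψ => v₀ + (1 - v₀) * cos ψ ^ 2 with hV
  have hVc : Continuous V := by simp only [hV]; fun_prop
  have hV0 : ∀ ψ, v₀ ≤ V ψ := fun ψ => by simp only [hV]; nlinarith [sq_nonneg (cos ψ)]
  have hV1 : ∀ ψ, V ψ ≤ 1 := fun ψ => by simp only [hV]; nlinarith [cos_sq_le_one ψ]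
  set σ : ℝ → Fin 3 → ℝ := fun ψ => ![V ψ, sin ψ * √((1 - v₀) * (1 + V ψ)),
    cos ψ * √((1 - v₀) * (2 * q - c * (V ψ + v₀)))] with hσ
  have hσc : Continuous σ := by
    refine continuous_pi fun i => ?_
    fin_cases i
    · exact hVc
    · change Continuous fun ψ => sin ψ * √((1 - v₀) * (1 + V ψ))
      fun_prop
    · change Continuous fun ψ => cos ψ * √((1 - v₀) * (2 * q - c * (V ψ + v₀)))
      fun_prop
  have hmem : Set.range σ ⊆ cylinderCurve !![0, 0, q; 0, c, 0; q, 0, r] := by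
    rintro _ ⟨ψ, rfl⟩
    rw [mem_cylinderCurve_oval]
    have h1 : √((1 - v₀) * (1 + V ψ)) ^ 2 = (1 - v₀) * (1 + V ψ) :=
      sq_sqrt (mul_nonneg (by linarith) (by linarith [hV0 ψ]))
    have h2 : √((1 - v₀) * (2 * q - c * (V ψ + v₀))) ^ 2 = (1 - v₀) * (2 * q - c * (V ψ + v₀)) :=
      sq_sqrt (mul_nonneg (by linarith) (hL _ (by linarith [hV0 ψ]) (hV1 ψ)).le)
    have h3 : V ψ = v₀ + (1 - v₀) * cos ψ ^ 2 := rfl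
    have h4 := sin_sq_add_cos_sq ψ
    have h5 := hfac (V ψ)
    simp only [hσ, Matrix.cons_val, mul_pow, h1, h2]
    have e1 : V ψ ^ 2 + sin ψ ^ 2 * ((1 - v₀) * (1 + V ψ)) = 1 := by
      linear_combination (1 - v₀) * (1 + V ψ) * h4 + (1 + V ψ) * h3
    refine ⟨e1, ?_⟩
    linear_combination -h5 - c * e1 - (2 * q - c * (V ψ + v₀)) * h3
  refine not_consistsOfTwoLoops_of_isPreconnected hM (isPreconnected_range hσc) hmem ?_ 0 ?_
  · intro p hp
    obtain ⟨h1, h2⟩ := mem_cylinderCurve_oval.1 (hmem hp)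
    unfold IsRegularPoint
    simp only [mulVec_dirVec]
    by_contra! hcon
    obtain ⟨h3, h4⟩ := hcon
    simp at h4
    rw [h3] at h2
    have h5 : p 1 * (c * p 0 - q) = 0 := by linear_combination h4
    rcases mul_eq_zero.1 h5 with h6 | h6
    · rw [h6] at h1 h2
      have h7 : (p 0 - 1) * (p 0 + 1) = 0 := by linear_combination h1
      rcases mul_eq_zero.1 h7 with h8 | h8
      · have : p 0 = 1 := by linarith
        rw [this] at h2; linarith
      · have : p 0 = -1 := by linarith
        rw [this] at h2; linarith
    · have hr : r = -(c * (1 + p 0 ^ 2)) := by linear_combination -h2 - c * h1 + 2 * p 0 * h6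
      have hq' : q = c * p 0 := by linarith
      rw [hr, hq'] at hr1 hr2
      rcases le_total 0 c with hc | hc
      · nlinarith [mul_nonneg hc (sq_nonneg (1 - p 0))]
      · nlinarith [mul_nonneg (neg_nonneg.2 hc) (sq_nonneg (1 + p 0))]
  · intro p hp
    left
    rw [mem_cylinderCurve_oval] at hp
    obtain ⟨h1, h2⟩ := hp
    have hp1 : -1 ≤ p 0 := by nlinarith [sq_nonneg (p 1)]
    have hp2 : p 0 ≤ 1 := by nlinarith [sq_nonneg (p 1)]
    have h3 : p 2 ^ 2 = (p 0 - v₀) * (2 * q - c * (p 0 + v₀)) := by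
      rw [← hfac]; linear_combination h2 + c * h1
    have hLp := hL _ hp1 hp2
    have hp3 : v₀ ≤ p 0 := by
      have : 0 ≤ (p 0 - v₀) * (2 * q - c * (p 0 + v₀)) := by rw [← h3]; positivity
      linarith [nonneg_of_mul_nonneg_left this hLp]
    have hA : 0 < (1 - v₀) * (1 + p 0) := mul_pos (by linarith) (by linarith)
    have hB : 0 < (1 - v₀) * (2 * q - c * (p 0 + v₀)) := mul_pos (by linarith) hLp
    have hA0 := (sqrt_pos.2 hA).ne'
    have hB0 := (sqrt_pos.2 hB).ne'
    have h4 : (p 2 / √((1 - v₀) * (2 * q - c * (p 0 + v₀)))) ^ 2 +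
        (p 1 / √((1 - v₀) * (1 + p 0))) ^ 2 = 1 := by
      rw [div_pow, div_pow, sq_sqrt hA.le, sq_sqrt hB.le, h3]
      have e1 : 1 - v₀ ≠ 0 := by linarith
      have e2 : 1 + p 0 ≠ 0 := by linarith
      have e3 := hLp.ne'
      field_simp
      linear_combination h1
    obtain ⟨t, hc, hs⟩ := exists_cos_sin_two_pi h4
    have hVt : V (2 * π * t) = p 0 := by
      have : cos (2 * π * t) ^ 2 = (p 0 - v₀) / (1 - v₀) := by
        rw [hc, div_pow, sq_sqrt hB.le, h3]
        have e1 : 1 - v₀ ≠ 0 := by linarith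
        have e3 := hLp.ne'
        field_simp
      simp only [hV, this]
      have e1 : 1 - v₀ ≠ 0 := by linarith
      field_simp
      ring
    refine ⟨2 * π * t, ?_⟩
    ext i
    fin_cases i
    · exact hVt
    · change sin (2 * π * t) * √((1 - v₀) * (1 + V (2 * π * t))) = p 1
      rw [hVt, hs, div_mul_cancel₀ _ hA0]
    · change cos (2 * π * t) * √((1 - v₀) * (2 * q - c * (V (2 * π * t) + v₀))) = p 2
      rw [hVt, hc, div_mul_cancel₀ _ hB0]

/-! ### Curves with a double point -/

theorem parabolicMatrix_isSymm (a b c : ℝ) : (parabolicMatrix a b c).IsSymm := by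
  ext i j
  fin_cases i <;> fin_cases j <;> rfl

theorem mem_cylinderCurve_parabolic {a b c : ℝ} {p : Fin 3 → ℝ} :
    p ∈ cylinderCurve (parabolicMatrix a b c) ↔ p 0 ^ 2 + p 1 ^ 2 = 1 ∧
      p 2 ^ 2 = a * p 1 ^ 2 + 2 * b * p 1 * (1 - p 0) + c * (1 - p 0) ^ 2 := by
  rw [mem_cylinderCurve_iff]
  refine and_congr_right fun _ => ?_
  simp [parabolicMatrix]
  constructor <;> intro h <;> linear_combination h

/-- The double point `(1, 0, 0)` of the curves of parabolic type. -/
def doublePoint : Fin 3 → ℝ := ![1, 0, 0]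

theorem doublePoint_mem (a b c : ℝ) : doublePoint ∈ cylinderCurve (parabolicMatrix a b c) := by
  rw [mem_cylinderCurve_parabolic]
  simp [doublePoint]

/-- The parametrization of the cylinder without the ruling `v = 1` by stereographic projection:
the coordinates are `u = w / (1 - v)` and `D = d / (1 - v)`. -/
def stereo (x : ℝ × ℝ) : Fin 3 → ℝ :=
  ![(x.1 ^ 2 - 1) / (x.1 ^ 2 + 1), 2 * x.1 / (x.1 ^ 2 + 1), 2 * x.2 / (x.1 ^ 2 + 1)]

theorem continuous_stereo : Continuous stereo := by
  have h : ∀ x : ℝ × ℝ, x.1 ^ 2 + 1 ≠ 0 := fun x => by positivity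
  refine continuous_pi fun i => ?_
  fin_cases i
  · exact Continuous.div (by fun_prop) (by fun_prop) h
  · exact Continuous.div (by fun_prop) (by fun_prop) h
  · exact Continuous.div (by fun_prop) (by fun_prop) h

theorem one_sub_stereo (x : ℝ × ℝ) : 1 - stereo x 0 = 2 / (x.1 ^ 2 + 1) := by
  have h : x.1 ^ 2 + 1 ≠ 0 := by positivity
  simp only [stereo, Matrix.cons_val]
  field_simp
  ring

theorem stereo_mem_iff {a b c : ℝ} (x : ℝ × ℝ) :
    stereo x ∈ cylinderCurve (parabolicMatrix a b c) ↔
      x.2 ^ 2 = a * x.1 ^ 2 + 2 * b * x.1 + c := by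
  have h : x.1 ^ 2 + 1 ≠ 0 := by positivity
  rw [mem_cylinderCurve_parabolic, one_sub_stereo]
  simp only [stereo, Matrix.cons_val]
  rw [and_iff_right (by field_simp; ring)]
  field_simp

/-- A point of the curve other than the double point is given by stereographic coordinates. -/
theorem exists_stereo {a b c : ℝ} {p : Fin 3 → ℝ}
    (hp : p ∈ cylinderCurve (parabolicMatrix a b c)) :
    (∃ x : ℝ × ℝ, stereo x = p) ∨ p = doublePoint := by
  obtain ⟨h1, h2⟩ := mem_cylinderCurve_parabolic.1 hp
  by_cases h0 : p 0 = 1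
  · right
    have hp1 : p 1 = 0 := by rw [h0] at h1; exact pow_eq_zero_iff two_ne_zero |>.1 (by linarith)
    have hp2 : p 2 = 0 := by
      rw [h0, hp1] at h2; exact pow_eq_zero_iff two_ne_zero |>.1 (by rw [h2]; ring)
    ext i
    fin_cases i <;> simp [doublePoint, h0, hp1, hp2]
  · left
    have h3 : 1 - p 0 ≠ 0 := fun h => h0 (by linarith)
    have h4 : (p 1 / (1 - p 0)) ^ 2 + 1 = 2 / (1 - p 0) := by
      field_simp; linear_combination h1
    have h5 : (p 1 / (1 - p 0)) ^ 2 - 1 = 2 * p 0 / (1 - p 0) := by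
      field_simp; linear_combination h1
    refine ⟨(p 1 / (1 - p 0), p 2 / (1 - p 0)), ?_⟩
    ext i
    fin_cases i
    · change ((p 1 / (1 - p 0)) ^ 2 - 1) / ((p 1 / (1 - p 0)) ^ 2 + 1) = p 0
      rw [h4, h5]; field_simp
    · change 2 * (p 1 / (1 - p 0)) / ((p 1 / (1 - p 0)) ^ 2 + 1) = p 1
      rw [h4]; field_simp
    · change 2 * (p 2 / (1 - p 0)) / ((p 1 / (1 - p 0)) ^ 2 + 1) = p 2
      rw [h4]; field_simp

/-- In stereographic coordinates, a point of the curve is regular if it is not a singular point of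
the conic `D² = a u² + 2 b u + c`. -/
theorem isRegularPoint_stereo {a b c : ℝ} {x : ℝ × ℝ}
    (hx : stereo x ∈ cylinderCurve (parabolicMatrix a b c)) (h : x.2 ≠ 0 ∨ a * x.1 + b ≠ 0) :
    IsRegularPoint (parabolicMatrix a b c) (stereo x) := by
  have h0 : x.1 ^ 2 + 1 ≠ 0 := by positivity
  rw [stereo_mem_iff] at hx
  by_cases h2 : x.2 = 0
  · right
    have h3 := h.resolve_left (not_not_intro h2)
    rw [h2] at hx
    simp only [mulVec_dirVec]
    have key : stereo x 0 * (parabolicMatrix a b c 1 0 * stereo x 0 +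
        parabolicMatrix a b c 1 1 * stereo x 1 + parabolicMatrix a b c 1 2) -
        stereo x 1 * (parabolicMatrix a b c 0 0 * stereo x 0 +
        parabolicMatrix a b c 0 1 * stereo x 1 + parabolicMatrix a b c 0 2) =
        -2 * (a * x.1 + b) / (x.1 ^ 2 + 1) := by
      simp [parabolicMatrix, stereo]
      field_simp
      linear_combination -4 * x.1 * hx
    rw [key]
    exact div_ne_zero (mul_ne_zero (by norm_num) h3) h0
  · left
    simp only [stereo, Matrix.cons_val]
    exact div_ne_zero (mul_ne_zero two_ne_zero h2) h0

/-- The tangent directions `(0, X₁, X₂)` of the branches at the double point satisfy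
`X₂² = a X₁²`. -/
theorem IsNondegenerateLoop.deriv_doublePoint {a b c : ℝ} {γ : ℝ → Fin 3 → ℝ}
    (hγ : IsNondegenerateLoop γ) (h : ∀ t, γ t ∈ cylinderCurve (parabolicMatrix a b c)) {t₀ : ℝ}
    (ht : γ t₀ = doublePoint) : deriv γ t₀ 0 = 0 ∧ deriv γ t₀ 2 ^ 2 = a * deriv γ t₀ 1 ^ 2 := by
  have h0 : deriv γ t₀ 0 = 0 := by
    have := hγ.deriv_circle (fun t => (h t).1) t₀
    simpa [ht, doublePoint] using this
  refine ⟨h0, ?_⟩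
  -- the equation of the curve is quadratic in the differences of the coordinates, hence it passes
  -- to the difference quotients and to their limits
  have s0 := hasDerivAt_iff_tendsto_slope.1 (hγ.hasDerivAt t₀ 0)
  have s1 := hasDerivAt_iff_tendsto_slope.1 (hγ.hasDerivAt t₀ 1)
  have s2 := hasDerivAt_iff_tendsto_slope.1 (hγ.hasDerivAt t₀ 2)
  have hr := (((s1.pow 2).const_mul a).sub ((s1.mul s0).const_mul (2 * b))).add
    ((s0.pow 2).const_mul c)
  have hl := s2.pow 2
  have heq : ∀ t, slope (fun s => γ s 2) t₀ t ^ 2 = a * slope (fun s => γ s 1) t₀ t ^ 2 -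
      2 * b * (slope (fun s => γ s 1) t₀ t * slope (fun s => γ s 0) t₀ t) +
      c * slope (fun s => γ s 0) t₀ t ^ 2 := by
    intro t
    have e := (mem_cylinderCurve_parabolic.1 (h t)).2
    simp only [slope_def_field, ht, doublePoint, Matrix.cons_val]
    linear_combination ((t - t₀)⁻¹) ^ 2 * e
  have := tendsto_nhds_unique (hl.congr heq) hr
  rw [this, h0]
  ring

theorem IsNondegenerateLoop.eq_zero_of_const_sign {γ : ℝ → Fin 3 → ℝ}
    (hγ : IsNondegenerateLoop γ) {i : Fin 3} {ε t₀ : ℝ} (hε : ε ≠ 0) (h : ∀ t, 0 ≤ ε * γ t i)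
    (ht : γ t₀ i = 0) : deriv γ t₀ i = 0 := by
  have hd := (hγ.hasDerivAt t₀ i).const_mul ε
  have hmin : IsLocalMin (fun t => ε * γ t i) t₀ :=
    Filter.Eventually.of_forall fun t => by simpa [ht] using h t
  have := hmin.hasDerivAt_eq_zero hd
  exact (mul_eq_zero.1 this).resolve_left hε

/-- A non-degenerate loop passes through the double point along one of the branches, so that it
crosses the planes `w = 0` and `d = 0`. -/
theorem IsNondegenerateLoop.not_const_sign {a b c : ℝ} (ha : a ≠ 0) {γ : ℝ → Fin 3 → ℝ}
    (hγ : IsNondegenerateLoop γ) (h : ∀ t, γ t ∈ cylinderCurve (parabolicMatrix a b c)) {t₀ : ℝ}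
    (ht : γ t₀ = doublePoint) {ε : ℝ} (hε : ε ≠ 0) :
    (¬ ∀ t, 0 ≤ ε * γ t 1) ∧ ¬ ∀ t, 0 ≤ ε * γ t 2 := by
  obtain ⟨e0, e2⟩ := hγ.deriv_doublePoint h ht
  have key : deriv γ t₀ 1 = 0 → deriv γ t₀ 2 = 0 → False := by
    intro h1 h2
    apply hγ.regular t₀
    ext i
    fin_cases i
    · exact e0
    · exact h1
    · exact h2
  constructor
  · intro hs
    have h1 := hγ.eq_zero_of_const_sign (t₀ := t₀) hε hs (by rw [ht]; rfl)
    rw [h1] at e2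
    exact key h1 (pow_eq_zero_iff two_ne_zero |>.1 (by rw [e2]; ring))
  · intro hs
    have h2 := hγ.eq_zero_of_const_sign (t₀ := t₀) hε hs (by rw [ht]; rfl)
    rw [h2] at e2
    refine key (pow_eq_zero_iff two_ne_zero |>.1 ?_) h2
    have : a * deriv γ t₀ 1 ^ 2 = 0 := by rw [← e2]; ring
    exact (mul_eq_zero.1 this).resolve_left ha

/-- If `a > 0`, the curve is a figure-eight (`c < 0`) or a closed curve with a node that winds
around the cylinder twice (`c > 0`): the two components of the complement of the node lie on
different sides of the plane `w = 0` or `d = 0`, but a loop would have to cross this plane at the node. If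
`a < 0`, the double point is isolated. -/
theorem not_consistsOfTwoLoops_node {a c : ℝ} (ha : a ≠ 0) (hc : c ≠ 0) :
    ¬ ConsistsOfTwoLoops (cylinderCurve (parabolicMatrix a 0 c)) := by
  intro h
  have hM := parabolicMatrix_isSymm a 0 c
  have hreg : ∀ x : ℝ × ℝ, stereo x ∈ cylinderCurve (parabolicMatrix a 0 c) →
      IsRegularPoint (parabolicMatrix a 0 c) (stereo x) := by
    intro x hx
    refine isRegularPoint_stereo hx ?_
    rw [stereo_mem_iff] at hx
    by_contra! hcon
    obtain ⟨h1, h2⟩ := hcon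
    have hx1 : x.1 = 0 := by
      rw [add_zero] at h2
      exact (mul_eq_zero.1 h2).resolve_left ha
    rw [h1, hx1] at hx
    exact hc (by linarith)
  -- it suffices to separate the curve by the sign of the coordinate `i`
  have key : ∀ i : Fin 3, (i = 1 ∨ i = 2) → ∀ σ : ℝ → ℝ → ℝ × ℝ, (∀ ε, Continuous (σ ε)) →
      (∀ ε s, ε ^ 2 = 1 → stereo (σ ε s) ∈ cylinderCurve (parabolicMatrix a 0 c) ∧
        0 ≤ ε * stereo (σ ε s) i) →
      (∀ x : ℝ × ℝ, stereo x ∈ cylinderCurve (parabolicMatrix a 0 c) →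
        x ∈ Set.range (σ 1) ∨ x ∈ Set.range (σ (-1))) → False := by
    intro i hi σ hσ hσC hall
    have hS : ∀ ε, IsPreconnected (Set.range fun s => stereo (σ ε s)) := fun ε =>
      isPreconnected_range (continuous_stereo.comp (hσ ε))
    have hSC : ∀ ε : ℝ, ε ^ 2 = 1 → (Set.range fun s => stereo (σ ε s)) ⊆
        cylinderCurve (parabolicMatrix a 0 c) := by
      rintro ε hε _ ⟨s, rfl⟩
      exact (hσC ε s hε).1
    have hSr : ∀ ε : ℝ, ε ^ 2 = 1 → ∀ p ∈ Set.range fun s => stereo (σ ε s),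
        IsRegularPoint (parabolicMatrix a 0 c) p := by
      rintro ε hε _ ⟨s, rfl⟩
      exact hreg _ (hσC ε s hε).1
    obtain ⟨γ₁, γ₂, hp, h1, h2⟩ := h.exists_of_pieces hM (hS 1) (hS (-1)) (hSC 1 (by norm_num))
      (hSC (-1) (by norm_num)) (hSr 1 (by norm_num)) (hSr (-1) (by norm_num)) doublePoint
      (by
        intro p hpC
        rcases exists_stereo hpC with ⟨x, rfl⟩ | hp
        · rcases hall x hpC with ⟨s, rfl⟩ | ⟨s, rfl⟩
          · exact Or.inl ⟨s, rfl⟩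
          · exact Or.inr (Or.inl ⟨s, rfl⟩)
        · exact Or.inr (Or.inr hp))
    have hzero : doublePoint i = 0 := by
      rcases hi with rfl | rfl <;> rfl
    have hsign : ∀ (γ : ℝ → Fin 3 → ℝ) (ε : ℝ), ε ^ 2 = 1 →
        (∀ t, (γ t ∈ Set.range fun s => stereo (σ ε s)) ∨ γ t = doublePoint) →
        ∀ t, 0 ≤ ε * γ t i := by
      intro γ ε hε hγ t
      rcases hγ t with ⟨s, hs⟩ | ht
      · rw [← hs]; exact (hσC ε s hε).2
      · rw [ht, hzero, mul_zero]
    have hnot : ∀ (γ : ℝ → Fin 3 → ℝ) (ε : ℝ), ε ≠ 0 → IsNondegenerateLoop γ →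
        (∀ t, γ t ∈ cylinderCurve (parabolicMatrix a 0 c)) → (∀ t, 0 ≤ ε * γ t i) →
        doublePoint ∉ Set.range γ := by
      rintro γ ε hε hγ hγC hs ⟨t, ht⟩
      have := hγ.not_const_sign ha hγC ht hε
      rcases hi with rfl | rfl
      · exact this.1 hs
      · exact this.2 hs
    rcases hp.mem (doublePoint_mem a 0 c) with hd | hd
    · exact hnot γ₁ 1 one_ne_zero hp.left hp.left_mem (hsign γ₁ 1 (by norm_num) h1) hd
    · exact hnot γ₂ (-1) (by norm_num) hp.right hp.right_mem (hsign γ₂ (-1) (by norm_num) h2) hd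
  rcases lt_or_gt_of_ne ha with ha' | ha'
  · -- the double point is isolated or the only point of the curve
    obtain ⟨γ₁, γ₂, hp⟩ := h.exists_loopPair
    have hnot : ∀ γ : ℝ → Fin 3 → ℝ, IsNondegenerateLoop γ →
        (∀ t, γ t ∈ cylinderCurve (parabolicMatrix a 0 c)) → doublePoint ∉ Set.range γ := by
      rintro γ hγ hγC ⟨t, ht⟩
      obtain ⟨e0, e2⟩ := hγ.deriv_doublePoint hγC ht
      have e1 : deriv γ t 1 = 0 := by
        have : deriv γ t 1 ^ 2 ≤ 0 := by
          nlinarith [sq_nonneg (deriv γ t 2), sq_nonneg (deriv γ t 1)]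
        exact pow_eq_zero_iff two_ne_zero |>.1 (le_antisymm this (sq_nonneg _))
      rw [e1] at e2
      have e2' : deriv γ t 2 = 0 := pow_eq_zero_iff two_ne_zero |>.1 (by rw [e2]; ring)
      apply hγ.regular t
      ext i
      fin_cases i
      · exact e0
      · exact e1
      · exact e2'
    rcases hp.mem (doublePoint_mem a 0 c) with hd | hd
    · exact hnot γ₁ hp.left hp.left_mem hd
    · exact hnot γ₂ hp.right hp.right_mem hd
  rcases lt_or_gt_of_ne hc with hc' | hc'
  · -- the hyperbola `D² = a u² + c` has the branches `u > 0` and `u < 0`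
    have hpos : ∀ s : ℝ, 0 ≤ (s ^ 2 - c) / a := fun s =>
      div_nonneg (by nlinarith [sq_nonneg s]) ha'.le
    refine key 1 (Or.inl rfl) (fun ε s => (ε * √((s ^ 2 - c) / a), s)) (fun ε => by fun_prop) ?_ ?_
    · intro ε s hε
      rw [stereo_mem_iff]
      refine ⟨?_, ?_⟩
      · simp only [mul_pow, hε, Real.sq_sqrt (hpos s)]
        field_simp
        ring
      · have e : ε * stereo (ε * √((s ^ 2 - c) / a), s) 1 =
            ε ^ 2 * (2 * √((s ^ 2 - c) / a) / ((ε * √((s ^ 2 - c) / a)) ^ 2 + 1)) := by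
          simp only [stereo, Matrix.cons_val]; ring
        rw [e, hε]
        positivity
    · intro x hx
      rw [stereo_mem_iff] at hx
      have hx1 : (x.2 ^ 2 - c) / a = x.1 ^ 2 := by rw [hx]; field_simp; ring
      rcases le_total 0 x.1 with h1 | h1
      · left
        exact ⟨x.2, by simp [hx1, Real.sqrt_sq h1]⟩
      · right
        exact ⟨x.2, by simp [hx1, Real.sqrt_sq_eq_abs, abs_of_nonpos h1]⟩
  · -- the hyperbola `D² = a u² + c` has the branches `D > 0` and `D < 0`
    have hpos : ∀ s : ℝ, 0 ≤ a * s ^ 2 + c := fun s => by positivity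
    refine key 2 (Or.inr rfl) (fun ε s => (s, ε * √(a * s ^ 2 + c))) (fun ε => by fun_prop) ?_ ?_
    · intro ε s hε
      rw [stereo_mem_iff]
      refine ⟨?_, ?_⟩
      · simp only [mul_pow, hε, Real.sq_sqrt (hpos s)]
        ring
      · have e : ε * stereo (s, ε * √(a * s ^ 2 + c)) 2 =
            ε ^ 2 * (2 * √(a * s ^ 2 + c) / (s ^ 2 + 1)) := by
          simp only [stereo, Matrix.cons_val]; ring
        rw [e, hε]
        positivity
    · intro x hx
      rw [stereo_mem_iff] at hx
      have hx1 : a * x.1 ^ 2 + c = x.2 ^ 2 := by rw [hx]; ring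
      rcases le_total 0 x.2 with h1 | h1
      · left
        exact ⟨x.1, by simp [hx1, Real.sqrt_sq h1]⟩
      · right
        exact ⟨x.1, by simp [hx1, Real.sqrt_sq_eq_abs, abs_of_nonpos h1]⟩

/-- A closed curve with a cusp: the complement of the cusp is the parabola `D² = 2 b u + c`. -/
theorem not_consistsOfTwoLoops_cusp {b : ℝ} (hb : b ≠ 0) (c : ℝ) :
    ¬ ConsistsOfTwoLoops (cylinderCurve (parabolicMatrix 0 b c)) := by
  set σ : ℝ → ℝ × ℝ := fun s => ((s ^ 2 - c) / (2 * b), s) with hσ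
  have hσc : Continuous σ := by simp only [hσ]; fun_prop
  have hmem : (Set.range fun s => stereo (σ s)) ⊆ cylinderCurve (parabolicMatrix 0 b c) := by
    rintro _ ⟨s, rfl⟩
    rw [stereo_mem_iff]
    simp only [hσ]
    field_simp
    ring
  refine not_consistsOfTwoLoops_of_isPreconnected (parabolicMatrix_isSymm 0 b c)
    (isPreconnected_range (continuous_stereo.comp hσc)) hmem ?_ doublePoint ?_
  · rintro _ ⟨s, rfl⟩
    exact isRegularPoint_stereo (hmem ⟨s, rfl⟩) (Or.inr (by simpa using hb))
  · intro p hp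
    rcases exists_stereo hp with ⟨x, rfl⟩ | h
    · left
      rw [stereo_mem_iff] at hp
      refine ⟨x.2, ?_⟩
      have : σ x.2 = x := by
        ext
        · simp only [hσ]; rw [hp]; field_simp; ring
        · rfl
      simp only [Function.comp_apply, this]
    · exact Or.inr h

/-- Two plane sections of the cylinder that touch: both loops pass through the point of contact,
where they have the same tangent. -/
theorem not_consistsOfTwoLoops_tacnode {c : ℝ} (hc : 0 < c) :
    ¬ ConsistsOfTwoLoops (cylinderCurve (parabolicMatrix 0 0 c)) := by
  intro h
  have hM := parabolicMatrix_isSymm 0 0 c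
  have hsq := Real.sq_sqrt hc.le
  have hsq0 := Real.sqrt_pos.2 hc
  have hC : ∀ ε s : ℝ, ε ^ 2 = 1 →
      stereo (s, ε * √c) ∈ cylinderCurve (parabolicMatrix 0 0 c) := by
    intro ε s hε
    rw [stereo_mem_iff]
    simp only [mul_pow, hε, hsq]
    ring
  have hS : ∀ ε : ℝ, IsPreconnected (Set.range fun s : ℝ => stereo (s, ε * √c)) := fun ε =>
    isPreconnected_range (continuous_stereo.comp (by fun_prop))
  have hSC : ∀ ε : ℝ, ε ^ 2 = 1 → (Set.range fun s : ℝ => stereo (s, ε * √c)) ⊆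
      cylinderCurve (parabolicMatrix 0 0 c) := by
    rintro ε hε _ ⟨s, rfl⟩
    exact hC ε s hε
  have hSr : ∀ ε : ℝ, ε ^ 2 = 1 → ∀ p ∈ Set.range fun s : ℝ => stereo (s, ε * √c),
      IsRegularPoint (parabolicMatrix 0 0 c) p := by
    rintro ε hε _ ⟨s, rfl⟩
    refine isRegularPoint_stereo (hC ε s hε) (Or.inl (mul_ne_zero ?_ hsq0.ne'))
    rintro rfl
    norm_num at hε
  obtain ⟨γ₁, γ₂, hp, h1, h2⟩ := h.exists_of_pieces hM (hS 1) (hS (-1)) (hSC 1 (by norm_num))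
    (hSC (-1) (by norm_num)) (hSr 1 (by norm_num)) (hSr (-1) (by norm_num)) doublePoint
    (by
      intro p hpC
      rcases exists_stereo hpC with ⟨x, rfl⟩ | hp
      · rw [stereo_mem_iff] at hpC
        have h3 : x.2 ^ 2 = √c ^ 2 := by rw [hpC, hsq]; ring
        rcases sq_eq_sq_iff_eq_or_eq_neg.1 h3 with h4 | h4
        · exact Or.inl ⟨x.1, by rw [one_mul, ← h4]⟩
        · exact Or.inr (Or.inl ⟨x.1, by rw [neg_one_mul, ← h4]⟩)
      · exact Or.inr (Or.inr hp))
  have hsign : ∀ (γ : ℝ → Fin 3 → ℝ) (ε : ℝ), ε ^ 2 = 1 →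
      (∀ t, (γ t ∈ Set.range fun s : ℝ => stereo (s, ε * √c)) ∨ γ t = doublePoint) →
      ∀ t, 0 ≤ ε * γ t 2 := by
    intro γ ε hε hγ t
    rcases hγ t with ⟨s, hs⟩ | ht
    · have e : ε * γ t 2 = ε ^ 2 * (2 * √c / (s ^ 2 + 1)) := by
        rw [← hs]; simp only [stereo, Matrix.cons_val]; ring
      rw [e, hε]
      positivity
    · simp [ht, doublePoint]
  -- the point of contact is a limit of points of the curve on either side of the plane `d = 0`,
  -- along a parametrization by `1 / u`
  have hlim : ∀ (γ γ' : ℝ → Fin 3 → ℝ) (ε : ℝ), ε ^ 2 = 1 →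
      IsLoopPair (cylinderCurve (parabolicMatrix 0 0 c)) γ γ' → (∀ t, 0 ≤ -ε * γ' t 2) →
      doublePoint ∈ Set.range γ := by
    intro γ γ' ε hε hpair hs
    set g : ℝ → Fin 3 → ℝ := fun s => ![(1 - s ^ 2) / (1 + s ^ 2), 2 * s / (1 + s ^ 2),
      2 * (ε * √c) * s ^ 2 / (1 + s ^ 2)] with hg
    have hne : ∀ s : ℝ, 1 + s ^ 2 ≠ 0 := fun s => by positivity
    have hgc : Continuous g := by
      refine continuous_pi fun i => ?_
      fin_cases i
      · exact Continuous.div (by fun_prop) (by fun_prop) hne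
      · exact Continuous.div (by fun_prop) (by fun_prop) hne
      · exact Continuous.div (by fun_prop) (by fun_prop) hne
    have hclosed : IsClosed (g ⁻¹' Set.range γ) := hpair.left.isClosed_range.preimage hgc
    have hsub : ({0}ᶜ : Set ℝ) ⊆ g ⁻¹' Set.range γ := by
      intro s hs0
      have hs0' : s ≠ 0 := hs0
      have hgC : g s ∈ cylinderCurve (parabolicMatrix 0 0 c) := by
        have := hne s
        rw [mem_cylinderCurve_parabolic]
        simp only [hg, Matrix.cons_val]
        constructor
        · field_simp; ring
        · field_simp
          rw [hε, hsq]
          ring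
      refine (hpair.mem hgC).resolve_right ?_
      rintro ⟨t, ht⟩
      have h3 := hs t
      have e : -ε * γ' t 2 = -(ε ^ 2 * (2 * √c * s ^ 2 / (1 + s ^ 2))) := by
        rw [ht]; simp only [hg, Matrix.cons_val]; ring
      rw [e, hε, one_mul] at h3
      have : 0 < 2 * √c * s ^ 2 / (1 + s ^ 2) := by positivity
      linarith
    have huniv : g ⁻¹' Set.range γ = Set.univ := by
      rw [← Set.univ_subset_iff, ← (dense_compl_singleton (0 : ℝ)).closure_eq]
      exact closure_minimal hsub hclosed
    have h0 : (0 : ℝ) ∈ g ⁻¹' Set.range γ := by rw [huniv]; trivial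
    have : g 0 = doublePoint := by
      ext i
      fin_cases i <;> simp [hg, doublePoint]
    rw [← this]
    exact h0
  obtain ⟨s, hs⟩ := hlim γ₁ γ₂ 1 (by norm_num) hp (hsign γ₂ (-1) (by norm_num) h2)
  obtain ⟨t, ht⟩ := hlim γ₂ γ₁ (-1) (by norm_num) hp.symm
    (by simpa using hsign γ₁ 1 (by norm_num) h1)
  have hli := hp.linearIndependent (hs.trans ht.symm)
  obtain ⟨e0, e2⟩ := hp.left.deriv_doublePoint hp.left_mem hs
  obtain ⟨f0, f2⟩ := hp.right.deriv_doublePoint hp.right_mem ht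
  have e2' : deriv γ₁ s 2 = 0 := pow_eq_zero_iff two_ne_zero |>.1 (by rw [e2, zero_mul])
  have f2' : deriv γ₂ t 2 = 0 := pow_eq_zero_iff two_ne_zero |>.1 (by rw [f2, zero_mul])
  rw [LinearIndependent.pair_iff] at hli
  have := hli (deriv γ₂ t 1) (-deriv γ₁ s 1) (by
    ext i
    fin_cases i
    · simp [e0, f0]
    · simp; ring
    · simp [e2', f2'])
  apply hp.left.regular s
  ext i
  fin_cases i
  · exact e0
  · simpa using this.2
  · exact e2'

/-! ### Two loops imply the normal form -/

theorem IsAssociatedPencil.isNormalizable {N : CheckerboardICNet} {P : Submodule ℝ QuadForm4}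
    (hP : IsAssociatedPencil N P) (hgen : IsGenericPencil P)
    (h : ConsistsOfTwoLoops (baseCurve P)) : N.IsNormalizable := by
  obtain ⟨M, hM, hMT⟩ := hP.exists_form hgen
  have hT : ∀ M', LorentzCongruent M M' → ∃ T : LaguerreTransformation,
      N.LiesOn T (cylinderCurve M') ∧ ConsistsOfTwoLoops (cylinderCurve M') := by
    rintro _ ⟨B, t, hB, rfl⟩
    obtain ⟨T, hT⟩ := hMT B t hB
    exact ⟨T, hT, (T.consistsOfTwoLoops_iff (fun p hp => hp.1)
      (hP.mem_baseCurve_iff_of_liesOn hgen hT)).1 h⟩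
  rcases exists_normalForm hM with ⟨a, b, e, hc⟩ | ⟨c, q, r, hr, hc⟩ | ⟨a, c, ha, hc0, hc⟩ |
    ⟨b, c, hc⟩
  · obtain ⟨T, hl, -⟩ := hT _ hc
    have key : cylinderCurve !![a, b, 0; b, e, 0; 0, 0, 0] ⊆ {q | (q 2 - 0 * q 0 - 0 * q 1) ^ 2 =
        a * q 0 ^ 2 + 2 * b * q 0 * q 1 + e * q 1 ^ 2} := by
      intro q hq
      have h1 := (mem_cylinderCurve_iff.1 hq).2
      simp at h1
      change (q 2 - 0 * q 0 - 0 * q 1) ^ 2 = a * q 0 ^ 2 + 2 * b * q 0 * q 1 + e * q 1 ^ 2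
      linear_combination h1
    exact hP.isNormalizable_of_binary hgen ⟨fun i => key (hl.1 i), fun j => key (hl.2 j)⟩
  · obtain ⟨T, -, h2⟩ := hT _ hc
    exact absurd h2 (not_consistsOfTwoLoops_oval hr)
  · obtain ⟨T, -, h2⟩ := hT _ hc
    exact absurd h2 (not_consistsOfTwoLoops_node ha hc0)
  · obtain ⟨T, hl, h2⟩ := hT _ hc
    by_cases hb : b = 0
    · subst hb
      rcases lt_or_ge 0 c with hc' | hc'
      · exact absurd h2 (not_consistsOfTwoLoops_tacnode hc')
      · have key : cylinderCurve (parabolicMatrix 0 0 c) ⊆ {p | p 2 = 0} := by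
          intro p hp
          have h1 := (mem_cylinderCurve_parabolic.1 hp).2
          have h3 : p 2 ^ 2 ≤ 0 := by nlinarith [sq_nonneg (1 - p 0)]
          exact pow_eq_zero_iff two_ne_zero |>.1 (le_antisymm h3 (sq_nonneg _))
        exact absurd ⟨fun i => key (hl.1 i), fun j => key (hl.2 j)⟩ (hP.not_liesOn_plane hgen T)
    · exact absurd h2 (not_consistsOfTwoLoops_cusp hb c)

end

theorem mainTheorem3 (N : CheckerboardICNet) (P : Submodule ℝ QuadForm4)
    (hP : IsAssociatedPencil N P) (hgen : IsGenericPencil P) :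
    (∃ N' : CheckerboardICNet, N'.IsConfocal ∧ LaguerreEquivalent N N') ↔
      ConsistsOfTwoLoops (baseCurve P) := by
  rw [hP.exists_confocal_iff hgen]
  exact ⟨hP.consistsOfTwoLoops hgen, hP.isNormalizable hgen⟩
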